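/- **Setting.** Let $\mu$ be a $\sigma$-finite measure on a measurable space $\mathbb X$, and let $\mathbb F$ be the set of all probability densities with respect to $\mu$. Let $X_1,X_2,\dots$ be i.i.d. from a probability measure $P_0$ with density $f_0\in\mathbb F$; "almost surely" refers to the infinite product measure $P_0^\infty$. Let $d$ be a (pseudo-)distance on $\mathbb F$ bounded above by the Hellinger distance $\|\sqrt f-\sqrt g\|_{L^2(\mu)}$, such that, for some constant $s>0$ and every fixed $g\in\mathbb F$, the function $f\mapsto d(f,g)^s$ is convex on $\mathbb F$. Put $$H_*(f,g)=\Big\|(\sqrt f-\sqrt g)\Big(\tfrac23\sqrt{\tfrac fg}+\tfrac13\Big)^{1/2}\Big\|_{L^2(\mu)}\in[0,\infty]$$ (with $0/0=0$ and $a/0=\infty$ for $a>0$). For every $n\ge1$ and $\gamma\in\{1,2\}$ let $\mathcal P_{n,\gamma}\subset\mathbb F$ be equipped with a $\sigma$-field for which $(x,f)\mapsto f(x)$ is jointly measurable on $\mathbb X\times\mathcal P_{n,\gamma}$, let $\Pi_{n,\gamma}$ be a probability measure on $\mathcal P_{n,\gamma}$, and let $\lambda_{n,1},\lambda_{n,2}\ge0$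 with $\lambda_{n,1}+\lambda_{n,2}=1$. Define $$W_{n,\gamma}(\varepsilon)=\{f\in\mathcal P_{n,\gamma}:H_*(f_0,f)\le\varepsilon\},\qquad A_{n,\gamma}(\varepsilon)=\{f\in\mathcal P_{n,\gamma}:d(f_0,f)\le\varepsilon\},$$ let $N(\delta,\mathcal G,d)$ be the minimal number of open $d$-balls of radius $\delta$ with centres in $\mathbb F$ needed to cover $\mathcal G$, and let $$R_n(f)=\prod_{i=1}^n\frac{f(X_i)}{f_0(X_i)},\qquad BF_n=\frac{\lambda_{n,2}\int_{\mathcal P_{n,2}}R_n(f)\,\Pi_{n,2}(df)}{\lambda_{n,1}\int_{\mathcal P_{n,1}}R_n(f)\,\Pi_{n,1}(df)}\in[0,\infty].$$ **Corollary.** Let $C,G,E_1,E_2>0$ be constants, let $r>700(2C+G+2)$, and let $\varepsilon_{n,1},\varepsilon_{n,2}$ satisfy $$\varepsilon_{n,1}>\varepsilon_{n,2}\ge\sqrt{\Big(1+\frac1C\Big)\frac{\log n}{n}}\qquad\text{for all }n\ge1.$$ Suppose that the entropy condition $$N\big(\tfrac\varepsilon3,A_{n,\gamma}(2\varepsilon),d\big)\le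 e^{E_\gamma n\varepsilon_{n,\gamma}^2}\qquad\text{for all }n\ge1,\ \gamma\in\{1,2\},\ \varepsilon\ge\varepsilon_{n,\gamma}$$ holds. (i) Suppose that $E_1\le G$ and $E_2\le G$, that for all $n\ge1$ $$\Pi_{n,2}(W_{n,2}(\varepsilon_{n,2}))\ge e^{-n\varepsilon_{n,2}^2}\quad\text{and}\quad\frac{\lambda_{n,1}}{\lambda_{n,2}}\le e^{n\varepsilon_{n,1}^2}$$ (in particular $\lambda_{n,2}>0$), and that $$\frac{\lambda_{n,1}}{\lambda_{n,2}}\,\Pi_{n,1}(A_{n,1}(r\varepsilon_{n,1}))=O\big(e^{-(4+3C)n\varepsilon_{n,2}^2}\big).$$ Then $BF_n\to\infty$ almost surely. (ii) Suppose that $E_1\le G$ and $E_2\varepsilon_{n,2}^2\le G\varepsilon_{n,1}^2$ for all $n\ge1$, that for all $n\ge1$ $$\Pi_{n,1}(W_{n,1}(\varepsilon_{n,1}))\ge e^{-n\varepsilon_{n,1}^2}\quad\text{and}\quad\frac{\lambda_{n,2}}{\lambda_{n,1}}\le e^{n\varepsilon_{n,1}^2}$$ (in particular $\lambda_{n,1}>0$),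 and that $$\frac{\lambda_{n,2}}{\lambda_{n,1}}\,\Pi_{n,2}(A_{n,2}(r\varepsilon_{n,1}))=O\big(e^{-(4+3C)n\varepsilon_{n,1}^2}\big).$$ Then $BF_n\to0$ almost surely. -/

import Mathlib

open MeasureTheory Filter Topology
open scoped ENNReal

noncomputable section

/-- The space of all probability densities with respect to `μ`, as real functions
(two densities which agree almost everywhere are not identified). -/
def densities {𝕏 : Type*} [MeasurableSpace 𝕏] (μ : Measure 𝕏) : Set (𝕏 → ℝ) :=
  {f | Measurable f ∧ (∀ x, 0 ≤ f x) ∧ ∫⁻ x, ENNReal.ofReal (f x) ∂μ = 1}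

/-- The Hellinger distance `‖√f - √g‖₂`. -/
def hellinger {𝕏 : Type*} [MeasurableSpace 𝕏] (μ : Measure 𝕏) (f g : 𝕏 → ℝ) : ℝ :=
  √(∫ x, (√(f x) - √(g x)) ^ 2 ∂μ)

/-- The modified Hellinger distance `‖(√f - √g) (2/3 √(f/g) + 1/3)^(1/2)‖₂`, with values in
`[0, ∞]`. In the quotient `f/g`, `0/0 = 0`, and `a/0 = ∞` for `a > 0`. -/
def hellingerStar {𝕏 : Type*} [MeasurableSpace 𝕏] (μ : Measure 𝕏) (f g : 𝕏 → ℝ) : ℝ≥0∞ :=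
  (∫⁻ x, ENNReal.ofReal ((√(f x) - √(g x)) ^ 2) *
      (2 / 3 * (ENNReal.ofReal (f x) / ENNReal.ofReal (g x)) ^ (1 / 2 : ℝ) + 1 / 3) ∂μ) ^
    (1 / 2 : ℝ)

/-- `d` is a distance on the space of densities which is bounded above by the Hellinger distance
and for which `d(f, g)^s` is a convex function of `f` for every fixed `g`.
It is not required that `d(f, g) = 0` only if `f = g` almost everywhere. -/
structure IsAdmissibleDistance {𝕏 : Type*} [MeasurableSpace 𝕏] (μ : Measure 𝕏)
    (d : (𝕏 → ℝ) → (𝕏 → ℝ) → ℝ) (s : ℝ) : Prop where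
  self : ∀ f ∈ densities μ, d f f = 0
  symm : ∀ f ∈ densities μ, ∀ g ∈ densities μ, d f g = d g f
  triangle : ∀ f ∈ densities μ, ∀ g ∈ densities μ, ∀ h ∈ densities μ, d f h ≤ d f g + d g h
  le_hellinger : ∀ f ∈ densities μ, ∀ g ∈ densities μ, d f g ≤ hellinger μ f g
  convexOn : ∀ g ∈ densities μ, ConvexOn ℝ (densities μ) (fun f => d f g ^ s)

/-- A density model together with its prior: a set of densities with a σ-field for which
`(x, f) ↦ f x` is jointly measurable, and a probability measure on it. -/
structure DensityModel {𝕏 : Type*} [mX : MeasurableSpace 𝕏] (μ : Measure 𝕏) where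
  carrier : Set (𝕏 → ℝ)
  subset_densities : carrier ⊆ densities μ
  sigmaField : MeasurableSpace carrier
  measurable_eval :
    @Measurable (𝕏 × carrier) ℝ (@Prod.instMeasurableSpace _ _ mX sigmaField) _
      (fun p => (p.2 : 𝕏 → ℝ) p.1)
  prior : @Measure carrier sigmaField
  isProbabilityMeasure : @IsProbabilityMeasure carrier sigmaField prior

/-- The prior mass which a model gives to a set of densities. -/
def DensityModel.priorMass {𝕏 : Type*} [MeasurableSpace 𝕏] {μ : Measure 𝕏} (M : DensityModel μ)
    (A : Set (𝕏 → ℝ)) : ℝ≥0∞ :=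
  M.prior {f | (f : 𝕏 → ℝ) ∈ A}

/-- `W(ε)`: the densities `f` of the model with `H_*(f₀, f) ≤ ε`. -/
def DensityModel.starBall {𝕏 : Type*} [MeasurableSpace 𝕏] {μ : Measure 𝕏} (M : DensityModel μ)
    (f₀ : 𝕏 → ℝ) (ε : ℝ) : Set (𝕏 → ℝ) :=
  {f | f ∈ M.carrier ∧ hellingerStar μ f₀ f ≤ ENNReal.ofReal ε}

/-- `A(ε)`: the densities `f` of the model with `d(f₀, f) ≤ ε`. -/
def DensityModel.distBall {𝕏 : Type*} [MeasurableSpace 𝕏] {μ : Measure 𝕏} (M : DensityModel μ)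
    (d : (𝕏 → ℝ) → (𝕏 → ℝ) → ℝ) (f₀ : 𝕏 → ℝ) (ε : ℝ) : Set (𝕏 → ℝ) :=
  {f | f ∈ M.carrier ∧ d f₀ f ≤ ε}

/-- The covering number `N(δ, A, d)`: the minimal number of open `d`-balls of radius `δ`, centred
at densities, needed to cover `A` (`⊤` if no finite number suffices). -/
def coveringNumber {𝕏 : Type*} [MeasurableSpace 𝕏] (μ : Measure 𝕏)
    (d : (𝕏 → ℝ) → (𝕏 → ℝ) → ℝ) (δ : ℝ) (A : Set (𝕏 → ℝ)) : ℕ∞ :=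
  ⨅ (S : Finset (𝕏 → ℝ)) (_ : (∀ g ∈ S, g ∈ densities μ) ∧ ∀ f ∈ A, ∃ g ∈ S, d f g < δ),
    (S.card : ℕ∞)

/-- The entropy condition for the `n`-th model with rate `ε` and constant `E`. -/
def EntropyCondition {𝕏 : Type*} [MeasurableSpace 𝕏] {μ : Measure 𝕏} (M : DensityModel μ)
    (d : (𝕏 → ℝ) → (𝕏 → ℝ) → ℝ) (f₀ : 𝕏 → ℝ) (n : ℕ) (ε E : ℝ) : Prop :=
  ∀ η : ℝ, ε ≤ η →
    (coveringNumber μ d (η / 3) (M.distBall d f₀ (2 * η)) : ℝ≥0∞) ≤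
      ENNReal.ofReal (Real.exp (E * n * ε ^ 2))

/-- The likelihood ratio `R_n(f)` of the first `n` observations of the sequence `ω`. -/
def likelihoodRatio {𝕏 : Type*} (f₀ f : 𝕏 → ℝ) (n : ℕ) (ω : ℕ → 𝕏) : ℝ≥0∞ :=
  ∏ i ∈ Finset.range n, ENNReal.ofReal (f (ω i)) / ENNReal.ofReal (f₀ (ω i))

/-- The integral of the likelihood ratio `R_n` with respect to the prior of a model. -/
def DensityModel.evidence {𝕏 : Type*} [MeasurableSpace 𝕏] {μ : Measure 𝕏} (M : DensityModel μ)
    (f₀ : 𝕏 → ℝ) (n : ℕ) (ω : ℕ → 𝕏) : ℝ≥0∞ :=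
  ∫⁻ f, likelihoodRatio f₀ (f : 𝕏 → ℝ) n ω ∂M.prior

/-- The Bayes factor of the model `M₂` with weight `w₂` against the model `M₁` with
weight `w₁`, after `n` observations. -/
def bayesFactor {𝕏 : Type*} [MeasurableSpace 𝕏] {μ : Measure 𝕏} (M₁ M₂ : DensityModel μ)
    (w₁ w₂ : ℝ≥0∞) (f₀ : 𝕏 → ℝ) (n : ℕ) (ω : ℕ → 𝕏) : ℝ≥0∞ :=
  (w₂ * M₂.evidence f₀ n ω) / (w₁ * M₁.evidence f₀ n ω)

end

noncomputable section

/-! The Bayes factor is a ratio of two weighted evidences. With `L = exp (-((4 + 2 * C) * n * a ^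
2))`, the evidence of the model with enough prior mass near `f₀` is almost surely eventually at
least `L / 2`, and the weighted evidence of the other one is eventually at most `δ * L` for every
fixed `δ > 0`. In part (i) the latter is the first model, with `a = ε₂`, `b = ε₁`; in part (ii) it
is the second, with `a = b = ε₁`. Each exceptional event has probability of order `exp (-(C * n * a
^ 2)) ≤ n ^ (-(C + 1))`, by the lower bound on the rates, so Borel–Cantelli applies.

Lower bound: on the `H_*`-ball of radius `a`, the likelihood ratio of one observation has moment of
order `-1/2` at most `exp (3 / 2 * a ^ 2)`, since `H_*² = 2/3 * (moment - 1)`. Markov's inequality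
for the integrated negative moment then prevents the evidence from being small.

Upper bound: split the prior at distance `r * b` from `f₀`. Inside, the mean of the integrated
likelihood ratio is at most the prior mass, which is small by assumption. Outside, cut into dyadic
shells and cover each by `d`-balls (`IsAdmissibleDistance.lintegral_sqrt_far_le`). Over one ball the
square root of the integrated likelihood ratio is estimated one observation at a time: the integral
of the current factor is a mixture of densities in the ball, which remains in the ball and hence
away from `f₀`, so each observation contributes a Hellinger affinity below one. The entropy is
absorbed because `r` is large.

That mixtures stay in the ball is Jensen's inequality for `d`
(`IsAdmissibleDistance.exists_mixture`). A closed `d`-ball of densities is a closed convex subset of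
`L¹`, so it contains Bochner barycentres. This requires the family of densities to be a strongly
measurable map into `L¹`, which follows from joint measurability. -/

/-! ### Strong measurability in `L¹` of jointly measurable families. -/

theorem MeasureTheory.Integrable.toL1_eq_zero {𝕏 : Type*} [MeasurableSpace 𝕏] {μ : Measure 𝕏}
    {f : 𝕏 → ℝ} (hf : Integrable f μ) (h : ∀ x, f x = 0) : hf.toL1 f = 0 := by
  obtain rfl : f = 0 := funext h
  exact Integrable.toL1_zero hf

/-- Dominated convergence in `L¹` for a family of functions, as a statement on strong
measurability of the curried family. -/
theorem stronglyMeasurable_toL1_of_tendsto {T 𝕏 : Type*} [MeasurableSpace T] [MeasurableSpace 𝕏]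
    {μ : Measure 𝕏} {F : T → 𝕏 → ℝ} {Fn : ℕ → T → 𝕏 → ℝ} {b : T → 𝕏 → ℝ}
    (hF : ∀ t, Integrable (F t) μ) (hFn : ∀ n t, Integrable (Fn n t) μ)
    (hb : ∀ t, Integrable (b t) μ) (hle : ∀ n t x, ‖Fn n t x‖ ≤ b t x)
    (hlim : ∀ t x, Tendsto (fun n => Fn n t x) atTop (𝓝 (F t x)))
    (hm : ∀ n, StronglyMeasurable fun t => (hFn n t).toL1 (Fn n t)) :
    StronglyMeasurable fun t => (hF t).toL1 (F t) := by
  refine stronglyMeasurable_of_tendsto atTop hm (tendsto_pi_nhds.2 fun t => ?_)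
  rw [tendsto_iff_edist_tendsto_0]
  simp only [Integrable.edist_toL1_toL1]
  have := tendsto_lintegral_norm_of_dominated_convergence (μ := μ) (F := fun n => Fn n t)
    (f := F t) (bound := b t) (fun n => (hFn n t).1) (hb t).2
    (fun n => ae_of_all _ (hle n t)) (ae_of_all _ (hlim t))
  refine this.congr fun n => lintegral_congr fun x => ?_
  rw [edist_dist, Real.dist_eq, Real.norm_eq_abs]

theorem integrable_indicator_section {T 𝕏 : Type*} [MeasurableSpace T] [MeasurableSpace 𝕏]
    {μ : Measure 𝕏} {Y : Set 𝕏} (hYfin : μ Y ≠ ∞) {S : Set (T × 𝕏)}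
    (hS : MeasurableSet S) (hY : MeasurableSet Y) (c : ℝ) (t : T) :
    Integrable (fun x => (S ∩ Prod.snd ⁻¹' Y).indicator (fun _ => c) (t, x)) μ := by
  have hm : MeasurableSet (Prod.mk t ⁻¹' (S ∩ Prod.snd ⁻¹' Y)) :=
    measurable_prodMk_left (hS.inter (measurable_snd hY))
  have : (fun x => (S ∩ Prod.snd ⁻¹' Y).indicator (fun _ => c) (t, x)) =
      (Prod.mk t ⁻¹' (S ∩ Prod.snd ⁻¹' Y)).indicator (fun _ => c) := by
    rfl
  rw [this]
  refine (integrable_indicator_iff hm).2 (integrableOn_const ?_)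
  exact ((measure_mono fun x hx => hx.2).trans_lt hYfin.lt_top).ne

/-- A π-λ argument: a rectangle gives a map with at most one nonzero value, and complements and
disjoint unions are handled by subtraction and dominated convergence. Truncation to `Y` of finite
measure keeps constants integrable. -/
theorem stronglyMeasurable_toL1_indicator {T 𝕏 : Type*} [MeasurableSpace T] [MeasurableSpace 𝕏]
    {μ : Measure 𝕏} {Y : Set 𝕏} (hYfin : μ Y ≠ ∞) (hY : MeasurableSet Y) (c : ℝ)
    (S : Set (T × 𝕏)) (hS : MeasurableSet S) :
    StronglyMeasurable fun t => (integrable_indicator_section hYfin hS hY c t).toL1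
      (fun x => (S ∩ Prod.snd ⁻¹' Y).indicator (fun _ => c) (t, x)) := by
  induction S, hS using MeasurableSpace.induction_on_inter generateFrom_prod.symm
    isPiSystem_prod with
  | empty =>
    have : ∀ t : T, (integrable_indicator_section hYfin .empty hY c t).toL1
      (fun x => ((∅ : Set (T × 𝕏)) ∩ Prod.snd ⁻¹' Y).indicator (fun _ => c) (t, x)) = 0 := by
      exact fun t => Integrable.toL1_eq_zero _ fun x => by simp
    simp only [this]
    exact stronglyMeasurable_const
  | basic S h =>
    obtain ⟨A, hA, B, hB, rfl⟩ := h
    have hI : Integrable ((B ∩ Y).indicator fun _ => c) μ :=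
      (integrable_indicator_iff (hB.inter hY)).2 (integrableOn_const
        ((measure_mono Set.inter_subset_right).trans_lt hYfin.lt_top).ne)
    classical
    have : (fun t => (integrable_indicator_section hYfin (hA.prod hB) hY c t).toL1
      (fun x => ((A ×ˢ B) ∩ Prod.snd ⁻¹' Y).indicator (fun _ => c) (t, x))) =
        A.indicator fun _ => hI.toL1 _ := by
      funext t
      by_cases ht : t ∈ A
      · rw [Set.indicator_of_mem ht, Integrable.toL1_eq_toL1_iff]
        exact ae_of_all _ fun x => by simp [Set.indicator, ht]
      · rw [Set.indicator_of_notMem ht]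
        exact Integrable.toL1_eq_zero _ fun x => by simp [Set.indicator, ht]
    rw [this]
    exact stronglyMeasurable_const.indicator hA
  | compl S hS ih =>
    have hI : Integrable (Y.indicator fun _ => c) μ :=
      (integrable_indicator_iff hY).2 (integrableOn_const hYfin)
    have : (fun t => (integrable_indicator_section hYfin hS.compl hY c t).toL1
      (fun x => (Sᶜ ∩ Prod.snd ⁻¹' Y).indicator (fun _ => c) (t, x))) =
        fun t => hI.toL1 _ - (integrable_indicator_section hYfin hS hY c t).toL1
      (fun x => (S ∩ Prod.snd ⁻¹' Y).indicator (fun _ => c) (t, x)) := by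
      funext t
      rw [← Integrable.toL1_sub, Integrable.toL1_eq_toL1_iff]
      refine ae_of_all _ fun x => ?_
      by_cases h1 : (t, x) ∈ S <;> by_cases h2 : x ∈ Y <;> simp [Set.indicator, h1, h2]
    rw [this]
    exact stronglyMeasurable_const.sub ih
  | iUnion f hdisj hfm ih =>
    have hpart : ∀ n, MeasurableSet (⋃ i ∈ Finset.range n, f i) := fun n =>
      Finset.measurableSet_biUnion _ fun i _ => hfm i
    refine stronglyMeasurable_toL1_of_tendsto
      (Fn := fun n t x => ((⋃ i ∈ Finset.range n, f i) ∩ Prod.snd ⁻¹' Y).indicator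
        (fun _ => c) (t, x)) (b := fun _ => Y.indicator fun _ => ‖c‖) _
      (fun n t => integrable_indicator_section hYfin (hpart n) hY c t)
      (fun t => (integrable_indicator_iff hY).2 (integrableOn_const hYfin)) ?_ ?_ ?_
    · intro n t x
      by_cases h2 : x ∈ Y
      · rw [Set.indicator_of_mem h2]
        exact norm_indicator_le_norm_self (fun _ => c) _
      · rw [Set.indicator_of_notMem h2, Set.indicator_of_notMem fun h => h2 h.2, norm_zero]
    · intro t x
      refine tendsto_const_nhds.congr' ?_
      by_cases h : ∃ i, (t, x) ∈ f i
      · obtain ⟨i, hi⟩ := h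
        filter_upwards [eventually_gt_atTop i] with n hn
        have h1 : (t, x) ∈ ⋃ i, f i := Set.mem_iUnion.2 ⟨i, hi⟩
        have h2 : (t, x) ∈ ⋃ i ∈ Finset.range n, f i :=
          Set.mem_biUnion (Finset.mem_coe.2 (Finset.mem_range.2 hn)) hi
        by_cases h3 : x ∈ Y <;> simp only [Set.indicator, Set.mem_inter_iff, h1, h2, h3,
          Set.mem_preimage]
      · push Not at h
        filter_upwards with n
        simp [Set.indicator, h]
    · intro n
      induction n with
      | zero =>
        have : ∀ t : T, (integrable_indicator_section hYfin (hpart 0) hY c t).toL1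
          (fun x => ((⋃ i ∈ Finset.range 0, f i) ∩ Prod.snd ⁻¹' Y).indicator
            (fun _ => c) (t, x)) = 0 := by
          exact fun t => Integrable.toL1_eq_zero _ fun x => by simp
        simp only [this]
        exact stronglyMeasurable_const
      | succ n ihn =>
        have : (fun t => (integrable_indicator_section hYfin (hpart (n + 1)) hY c t).toL1
            (fun x => ((⋃ i ∈ Finset.range (n + 1), f i) ∩ Prod.snd ⁻¹' Y).indicator
              (fun _ => c) (t, x))) =
            fun t => (integrable_indicator_section hYfin (hpart n) hY c t).toL1
            (fun x => ((⋃ i ∈ Finset.range n, f i) ∩ Prod.snd ⁻¹' Y).indicator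
              (fun _ => c) (t, x)) + (integrable_indicator_section hYfin (hfm n) hY c t).toL1
            (fun x => (f n ∩ Prod.snd ⁻¹' Y).indicator (fun _ => c) (t, x)) := by
          funext t
          rw [← Integrable.toL1_add, Integrable.toL1_eq_toL1_iff]
          refine ae_of_all _ fun x => ?_
          have hd : (t, x) ∈ f n → (t, x) ∉ ⋃ i ∈ Finset.range n, f i := by
            intro h h'
            simp only [Finset.mem_range, Set.mem_iUnion] at h'
            obtain ⟨i, hi, hx⟩ := h'
            exact Set.disjoint_left.1 (hdisj hi.ne) hx h
          have hs : (t, x) ∈ ⋃ i ∈ Finset.range (n + 1), f i ↔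
              (t, x) ∈ ⋃ i ∈ Finset.range n, f i ∨ (t, x) ∈ f n := by
            simp only [Finset.mem_range, Set.mem_iUnion, Nat.lt_succ_iff_lt_or_eq]
            grind
          by_cases h1 : (t, x) ∈ f n
          · have h2 := hd h1
            by_cases h3 : x ∈ Y <;>
              simp only [Set.indicator, Set.mem_inter_iff, hs, h1, h2, h3,
                Set.mem_preimage, Pi.add_apply] <;> simp
          · by_cases h2 : (t, x) ∈ ⋃ i ∈ Finset.range n, f i <;> by_cases h3 : x ∈ Y <;>
              simp only [Set.indicator, Set.mem_inter_iff, hs, h1, h2, h3,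
                Set.mem_preimage, Pi.add_apply] <;> simp
        rw [this]
        exact ihn.add (ih n)

theorem SimpleFunc.integrable_indicator_section {T 𝕏 : Type*} [MeasurableSpace T]
    [MeasurableSpace 𝕏] {μ : Measure 𝕏} {Y : Set 𝕏} (hYfin : μ Y ≠ ∞) (hY : MeasurableSet Y)
    (g : SimpleFunc (T × 𝕏) ℝ) (t : T) :
    Integrable (Y.indicator fun x => g (t, x)) μ := by
  obtain ⟨C, hC⟩ := g.exists_forall_norm_le
  refine (integrable_indicator_iff hY).2 ?_
  exact Measure.integrableOn_of_bounded hYfin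
    (g.measurable.comp measurable_prodMk_left).aestronglyMeasurable
    (ae_of_all _ fun x => hC _)

theorem SimpleFunc.stronglyMeasurable_toL1 {T 𝕏 : Type*} [MeasurableSpace T]
    [MeasurableSpace 𝕏] {μ : Measure 𝕏} {Y : Set 𝕏} (hYfin : μ Y ≠ ∞) (hY : MeasurableSet Y)
    (g : SimpleFunc (T × 𝕏) ℝ) :
    StronglyMeasurable fun t => (SimpleFunc.integrable_indicator_section hYfin hY g t).toL1
      (Y.indicator fun x => g (t, x)) := by
  induction g using SimpleFunc.induction with
  | const c hs =>
    rename_i S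
    convert stronglyMeasurable_toL1_indicator hYfin hY c S hs using 2 with t
    rw [Integrable.toL1_eq_toL1_iff]
    refine ae_of_all _ fun x => ?_
    by_cases h1 : (t, x) ∈ S <;> by_cases h2 : x ∈ Y <;> simp [Set.indicator, h1, h2]
  | add hd hf hg =>
    convert hf.add hg using 2 with t
    simp only [Pi.add_apply]
    rw [← Integrable.toL1_add, Integrable.toL1_eq_toL1_iff]
    refine ae_of_all _ fun x => ?_
    by_cases h2 : x ∈ Y <;> simp [Set.indicator, h2]

/-- A jointly measurable family of integrable functions is a strongly measurable family of
elements of `L¹`. -/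
theorem stronglyMeasurable_toL1 {T 𝕏 : Type*} [MeasurableSpace T]
    [MeasurableSpace 𝕏] {μ : Measure 𝕏} [SigmaFinite μ] {F : T → 𝕏 → ℝ}
    (hm : Measurable (Function.uncurry F)) (hF : ∀ t, Integrable (F t) μ) :
    StronglyMeasurable fun t => (hF t).toL1 (F t) := by
  let g : ℕ → SimpleFunc (T × 𝕏) ℝ :=
    SimpleFunc.approxOn (Function.uncurry F) hm Set.univ 0 (Set.mem_univ _)
  -- Simple approximants need not be integrable in `x`, so the `n`-th one is cut off to the `n`-th
  -- spanning set. The approximants satisfy `‖g n‖ ≤ ‖F‖ + ‖F‖`, hence this dominating function.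
  refine stronglyMeasurable_toL1_of_tendsto
    (Fn := fun n t => (spanningSets μ n).indicator fun x => g n (t, x))
    (b := fun t x => ‖F t x‖ + ‖F t x‖) hF
    (fun n t => SimpleFunc.integrable_indicator_section (measure_spanningSets_lt_top μ n).ne
      (measurableSet_spanningSets μ n) (g n) t)
    (fun t => (hF t).norm.add (hF t).norm) ?_ ?_
    (fun n => SimpleFunc.stronglyMeasurable_toL1 (measure_spanningSets_lt_top μ n).ne
      (measurableSet_spanningSets μ n) (g n))
  · intro n t x
    refine (norm_indicator_le_norm_self _ _).trans ?_
    exact SimpleFunc.norm_approxOn_zero_le hm (Set.mem_univ _) (t, x) n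
  · intro t x
    have h1 : Tendsto (fun n => g n (t, x)) atTop (𝓝 (F t x)) :=
      SimpleFunc.tendsto_approxOn hm (Set.mem_univ _) (by simp)
    refine h1.congr' ?_
    filter_upwards [eventually_ge_atTop (spanningSetsIndex μ x)] with n hn
    rw [Set.indicator_of_mem]
    exact monotone_spanningSets μ hn (mem_spanningSetsIndex μ x)

/-! ### Densities, `d`-balls in `L¹`, and Jensen's inequality for `d`. -/

theorem sq_sqrt_sub_sqrt_le_abs {a b : ℝ} (ha : 0 ≤ a) (hb : 0 ≤ b) :
    (√a - √b) ^ 2 ≤ |a - b| := by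
  have h1 : a - b = (√a - √b) * (√a + √b) := by
    nlinarith [Real.sq_sqrt ha, Real.sq_sqrt hb]
  have h2 : |√a - √b| ≤ √a + √b := by
    rw [abs_le]; constructor <;> linarith [Real.sqrt_nonneg a, Real.sqrt_nonneg b]
  rw [h1, abs_mul, abs_of_nonneg (by positivity : 0 ≤ √a + √b), ← sq_abs, sq]
  exact mul_le_mul_of_nonneg_left h2 (abs_nonneg _)

section densities

variable {𝕏 : Type*} [MeasurableSpace 𝕏] {μ : Measure 𝕏}

theorem integrable_of_mem_densities {f : 𝕏 → ℝ} (hf : f ∈ densities μ) : Integrable f μ := by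
  refine ⟨hf.1.aestronglyMeasurable, ?_⟩
  rw [hasFiniteIntegral_iff_ofReal (ae_of_all _ hf.2.1), hf.2.2]
  exact ENNReal.one_lt_top

theorem integral_of_mem_densities {f : 𝕏 → ℝ} (hf : f ∈ densities μ) : ∫ x, f x ∂μ = 1 := by
  rw [integral_eq_lintegral_of_nonneg_ae (ae_of_all _ hf.2.1) hf.1.aestronglyMeasurable, hf.2.2]
  rfl

theorem mem_densities_of_integral {f : 𝕏 → ℝ} (hm : Measurable f) (h0 : ∀ x, 0 ≤ f x)
    (hi : Integrable f μ) (h1 : ∫ x, f x ∂μ = 1) : f ∈ densities μ := by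
  refine ⟨hm, h0, ?_⟩
  rw [← ofReal_integral_eq_lintegral_ofReal hi (ae_of_all _ h0), h1, ENNReal.ofReal_one]

theorem integrable_sq_sqrt_sub {f g : 𝕏 → ℝ} (hf : f ∈ densities μ) (hg : g ∈ densities μ) :
    Integrable (fun x => (√(f x) - √(g x)) ^ 2) μ := by
  refine (((integrable_of_mem_densities hf).sub (integrable_of_mem_densities hg)).norm).mono'
    ((hf.1.sqrt.sub hg.1.sqrt).pow_const 2).aestronglyMeasurable (ae_of_all _ fun x => ?_)
  rw [Real.norm_of_nonneg (sq_nonneg _)]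
  exact sq_sqrt_sub_sqrt_le_abs (hf.2.1 x) (hg.2.1 x)

theorem hellinger_le_sqrt_integral {f g : 𝕏 → ℝ} (hf : f ∈ densities μ) (hg : g ∈ densities μ) :
    hellinger μ f g ≤ √(∫ x, |f x - g x| ∂μ) := by
  refine Real.sqrt_le_sqrt (integral_mono (integrable_sq_sqrt_sub hf hg)
    (((integrable_of_mem_densities hf).sub (integrable_of_mem_densities hg)).norm) fun x => ?_)
  exact sq_sqrt_sub_sqrt_le_abs (hf.2.1 x) (hg.2.1 x)

theorem hellinger_eq_zero_of_ae_eq {f g : 𝕏 → ℝ} (h : f =ᵐ[μ] g) : hellinger μ f g = 0 := by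
  have : (fun x => (√(f x) - √(g x)) ^ 2) =ᵐ[μ] 0 := by
    filter_upwards [h] with x hx
    simp [hx]
  rw [hellinger, integral_congr_ae this]
  simp

theorem hellinger_sq {f g : 𝕏 → ℝ} : hellinger μ f g ^ 2 = ∫ x, (√(f x) - √(g x)) ^ 2 ∂μ :=
  Real.sq_sqrt (integral_nonneg fun _ => sq_nonneg _)

variable {d : (𝕏 → ℝ) → (𝕏 → ℝ) → ℝ} {s : ℝ}

theorem IsAdmissibleDistance.nonneg (hd : IsAdmissibleDistance μ d s) {f g : 𝕏 → ℝ}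
    (hf : f ∈ densities μ) (hg : g ∈ densities μ) : 0 ≤ d f g := by
  have := hd.triangle f hf g hg f hf
  rw [hd.self f hf, hd.symm g hg f hf] at this
  linarith

/-- The classes in `L¹` of the densities in the closed `d`-ball of radius `δ` around `g`. -/
def distBallL1 (μ : Measure 𝕏) (d : (𝕏 → ℝ) → (𝕏 → ℝ) → ℝ) (g : 𝕏 → ℝ) (δ : ℝ) :
    Set (𝕏 →₁[μ] ℝ) :=
  {φ | ∃ h ∈ densities μ, h =ᵐ[μ] φ ∧ d h g ≤ δ}

/-- Because `d` is below the Hellinger distance, it does not see changes on null sets, so balls can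
be described by classes. -/
theorem IsAdmissibleDistance.toL1_mem_distBallL1_iff (hd : IsAdmissibleDistance μ d s)
    {f g : 𝕏 → ℝ} (hf : f ∈ densities μ) (hg : g ∈ densities μ) {δ : ℝ}
    (hi : Integrable f μ) : hi.toL1 f ∈ distBallL1 μ d g δ ↔ d f g ≤ δ := by
  refine ⟨fun ⟨h, hh, hfh, hle⟩ => ?_, fun h => ⟨f, hf, hi.coeFn_toL1.symm, h⟩⟩
  have h1 := hd.triangle f hf h hh g hg
  have h2 := hd.le_hellinger f hf h hh
  rw [hellinger_eq_zero_of_ae_eq (hi.coeFn_toL1.symm.trans hfh.symm)] at h2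
  linarith

/-- Sublevel sets of `d` are those of the convex function `d ^ s`, since `x ↦ x ^ s` is increasing
on `[0, ∞)`. -/
theorem IsAdmissibleDistance.convex_distBallL1 (hd : IsAdmissibleDistance μ d s) (hs : 0 < s)
    {g : 𝕏 → ℝ} (hg : g ∈ densities μ) {δ : ℝ} : Convex ℝ (distBallL1 μ d g δ) := by
  rintro φ ⟨h, hh, hφ, hle⟩ ψ ⟨k, hk, hψ, kle⟩ a b ha hb hab
  have hc := hd.convexOn g hg
  have hδ : 0 ≤ δ := (hd.nonneg hh hg).trans hle
  have hmem := hc.1 hh hk ha hb hab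
  refine ⟨a • h + b • k, hmem, ?_, ?_⟩
  · filter_upwards [Lp.coeFn_add (a • φ) (b • ψ), Lp.coeFn_smul a φ, Lp.coeFn_smul b ψ,
      hφ, hψ] with x h1 h2 h3 h4 h5
    refine Eq.trans ?_ (h1.trans (congrArg₂ (· + ·) h2 h3)).symm
    simp [h4, h5]
  · have h1 := hc.2 hh hk ha hb hab
    have h2 : d h g ^ s ≤ δ ^ s := Real.rpow_le_rpow (hd.nonneg hh hg) hle hs.le
    have h3 : d k g ^ s ≤ δ ^ s := Real.rpow_le_rpow (hd.nonneg hk hg) kle hs.le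
    have h4 : d (a • h + b • k) g ^ s ≤ δ ^ s := by
      refine h1.trans ?_
      simp only [smul_eq_mul]
      calc a * d h g ^ s + b * d k g ^ s ≤ a * δ ^ s + b * δ ^ s := by gcongr
        _ = δ ^ s := by rw [← add_mul, hab, one_mul]
    exact (Real.rpow_le_rpow_iff (hd.nonneg hmem hg) hδ hs).1 h4

/-- An `L¹`-limit of densities is nonnegative a.e. with integral one, so its positive part is a
density representing it. The distance passes to the limit because `d` is at most the square root of
the `L¹`-distance. -/
theorem IsAdmissibleDistance.isClosed_distBallL1 (hd : IsAdmissibleDistance μ d s)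
    {g : 𝕏 → ℝ} (hg : g ∈ densities μ) {δ : ℝ} : IsClosed (distBallL1 μ d g δ) := by
  refine IsSeqClosed.isClosed fun u φ hu hlim => ?_
  choose h hh hae hle using hu
  have hnn : 0 ≤ᵐ[μ] φ := by
    rw [Lp.coeFn_nonneg]
    refine ge_of_tendsto' hlim fun n => ?_
    rw [← Lp.coeFn_nonneg]
    filter_upwards [hae n] with x hx
    rw [← hx]
    exact (hh n).2.1 x
  have hint : ∫ x, φ x ∂μ = 1 := by
    refine tendsto_nhds_unique ((continuous_integral.tendsto φ).comp hlim) ?_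
    refine tendsto_const_nhds.congr fun n => ?_
    rw [Function.comp_apply, ← integral_congr_ae (hae n), integral_of_mem_densities (hh n)]
  have hk : (fun x => max (φ x) 0) =ᵐ[μ] φ := by
    filter_upwards [hnn] with x hx using max_eq_left hx
  have hmem : (fun x => max (φ x) 0) ∈ densities μ :=
    mem_densities_of_integral ((Lp.stronglyMeasurable φ).measurable.max measurable_const)
      (fun x => le_max_right _ _) ((L1.integrable_coeFn φ).congr hk.symm)
      ((integral_congr_ae hk).trans hint)
  refine ⟨_, hmem, hk, ?_⟩
  have hlim' : Tendsto (fun n => √(dist (u n) φ) + δ) atTop (𝓝 (√0 + δ)) :=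
    ((Real.continuous_sqrt.tendsto 0).comp (tendsto_iff_dist_tendsto_zero.1 hlim)).add_const δ
  rw [Real.sqrt_zero, zero_add] at hlim'
  refine ge_of_tendsto' hlim' fun n => ?_
  refine (hd.triangle _ hmem _ (hh n) g hg).trans (add_le_add ?_ (hle n))
  refine (hd.le_hellinger _ hmem _ (hh n)).trans ((hellinger_le_sqrt_integral hmem (hh n)).trans ?_)
  refine Real.sqrt_le_sqrt (le_of_eq ?_)
  rw [dist_comm, dist_eq_norm, L1.norm_eq_integral_norm]
  refine integral_congr_ae ?_
  filter_upwards [hk, hae n, Lp.coeFn_sub φ (u n)] with x h1 h2 h3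
  rw [h3, h1, h2, Pi.sub_apply, Real.norm_eq_abs]

variable {T : Type*} [MeasurableSpace T] [SigmaFinite μ] {F : T → 𝕏 → ℝ}

theorem IsAdmissibleDistance.measurableSet_le (hd : IsAdmissibleDistance μ d s)
    (hm : Measurable (Function.uncurry F)) (hF : ∀ t, F t ∈ densities μ)
    {g : 𝕏 → ℝ} (hg : g ∈ densities μ) (δ : ℝ) : MeasurableSet {t | d (F t) g ≤ δ} := by
  have hi := fun t => integrable_of_mem_densities (hF t)
  have h := stronglyMeasurable_toL1 (μ := μ) hm hi
  let _ : MeasurableSpace (𝕏 →₁[μ] ℝ) := borel _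
  have : BorelSpace (𝕏 →₁[μ] ℝ) := ⟨rfl⟩
  convert h.measurable (hd.isClosed_distBallL1 hg (δ := δ)).measurableSet using 1
  ext t
  exact (hd.toL1_mem_distBallL1_iff (hF t) hg (hi t)).symm

theorem integrable_toL1_densities (hm : Measurable (Function.uncurry F))
    (hF : ∀ t, F t ∈ densities μ) (Q : Measure T) [IsFiniteMeasure Q]
    (hi : ∀ t, Integrable (F t) μ) : Integrable (fun t => (hi t).toL1 (F t)) Q := by
  refine Integrable.of_bound (stronglyMeasurable_toL1 hm hi).aestronglyMeasurable 1
    (ae_of_all _ fun t => ?_)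
  rw [Integrable.norm_toL1_eq_lintegral_enorm]
  have : ∫⁻ x, ‖F t x‖ₑ ∂μ = 1 := by
    rw [← (hF t).2.2]
    refine lintegral_congr fun x => ?_
    rw [Real.enorm_of_nonneg ((hF t).2.1 x)]
  rw [this]; simp

/-- The Bochner integral of a family of densities is represented by the pointwise mixture. -/
theorem ofReal_integral_toL1_ae_eq (hm : Measurable (Function.uncurry F))
    (hF : ∀ t, F t ∈ densities μ) (Q : Measure T) [IsProbabilityMeasure Q]
    (hi : ∀ t, Integrable (F t) μ) {h : 𝕏 → ℝ} (hh : h ∈ densities μ)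
    (hae : h =ᵐ[μ] (∫ t, (hi t).toL1 (F t) ∂Q : 𝕏 →₁[μ] ℝ)) :
    (fun x => ENNReal.ofReal (h x)) =ᵐ[μ] fun x => ∫⁻ t, ENNReal.ofReal (F t x) ∂Q := by
  have hm' : Measurable fun p : 𝕏 × T => ENNReal.ofReal (F p.2 p.1) :=
    (hm.comp measurable_swap).ennreal_ofReal
  refine ae_eq_of_forall_setLIntegral_eq_of_sigmaFinite hh.1.ennreal_ofReal
    hm'.lintegral_prod_right' fun A hA _ => ?_
  have hΦ := integrable_toL1_densities hm hF Q hi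
  -- Integration over `A`, as a continuous linear functional, commutes with the Bochner integral;
  -- Tonelli then identifies the result with the integral of the pointwise mixture.
  let L : (𝕏 →₁[μ] ℝ) →L[ℝ] ℝ :=
    (L1.integralCLM (μ := μ.restrict A) (E := ℝ)).comp (LpToLpRestrictCLM 𝕏 ℝ ℝ μ 1 A)
  have hL : ∀ φ : 𝕏 →₁[μ] ℝ, L φ = ∫ x in A, φ x ∂μ := by
    intro φ
    rw [← integral_congr_ae (LpToLpRestrictCLM_coeFn ℝ A φ)]
    exact (L1.integral_eq (LpToLpRestrictCLM 𝕏 ℝ ℝ μ 1 A φ)).symm.trans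
      (L1.integral_eq_integral (LpToLpRestrictCLM 𝕏 ℝ ℝ μ 1 A φ))
  have hLt : ∀ t, ENNReal.ofReal (L ((hi t).toL1 (F t))) =
      ∫⁻ x in A, ENNReal.ofReal (F t x) ∂μ := by
    intro t
    rw [hL, integral_congr_ae (ae_restrict_of_ae (hi t).coeFn_toL1),
      ofReal_integral_eq_lintegral_ofReal (hi t).integrableOn
        (ae_of_all _ (hF t).2.1)]
  have hLnn : ∀ t, 0 ≤ L ((hi t).toL1 (F t)) := by
    intro t
    rw [hL, integral_congr_ae (ae_restrict_of_ae (hi t).coeFn_toL1)]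
    exact integral_nonneg (hF t).2.1
  calc ∫⁻ x in A, ENNReal.ofReal (h x) ∂μ = ENNReal.ofReal (∫ x in A, h x ∂μ) :=
        (ofReal_integral_eq_lintegral_ofReal (integrable_of_mem_densities hh).integrableOn
          (ae_of_all _ hh.2.1)).symm
    _ = ENNReal.ofReal (L (∫ t, (hi t).toL1 (F t) ∂Q)) := by
        rw [hL, integral_congr_ae (ae_restrict_of_ae hae)]
    _ = ENNReal.ofReal (∫ t, L ((hi t).toL1 (F t)) ∂Q) := by
        rw [L.integral_comp_comm hΦ]
    _ = ∫⁻ t, ENNReal.ofReal (L ((hi t).toL1 (F t))) ∂Q :=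
        ofReal_integral_eq_lintegral_ofReal (L.integrable_comp hΦ) (ae_of_all _ hLnn)
    _ = ∫⁻ t, ∫⁻ x in A, ENNReal.ofReal (F t x) ∂μ ∂Q := lintegral_congr hLt
    _ = ∫⁻ x in A, ∫⁻ t, ENNReal.ofReal (F t x) ∂Q ∂μ :=
        lintegral_lintegral_swap hm.ennreal_ofReal.aemeasurable

/-- Jensen's inequality for `d`: a mixture of densities which lie in a closed `d`-ball lies in
that ball. -/
theorem IsAdmissibleDistance.exists_mixture (hd : IsAdmissibleDistance μ d s) (hs : 0 < s)
    (hm : Measurable (Function.uncurry F)) (hF : ∀ t, F t ∈ densities μ)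
    (Q : Measure T) [IsProbabilityMeasure Q] {g : 𝕏 → ℝ} (hg : g ∈ densities μ) {δ : ℝ}
    (hQ : ∀ᵐ t ∂Q, d (F t) g ≤ δ) :
    ∃ h ∈ densities μ, d h g ≤ δ ∧
      (fun x => ENNReal.ofReal (h x)) =ᵐ[μ] fun x => ∫⁻ t, ENNReal.ofReal (F t x) ∂Q := by
  have hi := fun t => integrable_of_mem_densities (hF t)
  have hΦ := integrable_toL1_densities hm hF Q hi
  obtain ⟨h, hh, hae, hle⟩ := (hd.convex_distBallL1 hs hg (δ := δ)).integral_mem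
    (hd.isClosed_distBallL1 hg)
    (hQ.mono fun t ht => (hd.toL1_mem_distBallL1_iff (hF t) hg (hi t)).2 ht) hΦ
  exact ⟨h, hh, hle, ofReal_integral_toL1_ae_eq hm hF Q hi hh hae⟩

end densities

/-! ### Integrated products of i.i.d. terms. -/

section product

variable {𝕏 T : Type*} [MeasurableSpace 𝕏] [MeasurableSpace T] {P : Measure 𝕏}
  [IsProbabilityMeasure P]

theorem lintegral_infinitePi_fin {n : ℕ} {g : (Fin n → 𝕏) → ℝ≥0∞} (hg : Measurable g) :
    ∫⁻ ω, g (fun i => ω i) ∂(Measure.infinitePi fun _ : ℕ => P) =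
      ∫⁻ y, g y ∂(Measure.pi fun _ : Fin n => P) := by
  rw [← Measure.infinitePi_eq_pi,
    ← Measure.map_infinitePi_infinitePi_of_inj (P := fun _ : ℕ => P) (f := fun i : Fin n => (i : ℕ))
      Fin.val_injective, lintegral_map hg (by fun_prop)]

theorem lintegral_pi_fin_succ {n : ℕ} {g : (Fin (n + 1) → 𝕏) → ℝ≥0∞} (hg : Measurable g) :
    ∫⁻ y, g y ∂(Measure.pi fun _ : Fin (n + 1) => P) =
      ∫⁻ x, ∫⁻ y, g (Fin.cons x y) ∂(Measure.pi fun _ : Fin n => P) ∂P := by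
  have h := (measurePreserving_piFinSuccAbove (fun _ : Fin (n + 1) => P) 0).symm
  rw [← h.lintegral_comp hg]
  refine (lintegral_prod (μ := P) (ν := Measure.pi fun _ : Fin n => P)
    (fun p => g ((MeasurableEquiv.piFinSuccAbove (fun _ => 𝕏) 0).symm p))
    (hg.comp (MeasurableEquiv.measurable _)).aemeasurable).trans
    (lintegral_congr fun x => lintegral_congr fun y => congrArg g ?_)
  exact Fin.insertNth_zero' x y

theorem lintegral_pi_fin_prod (n : ℕ) {φ : 𝕏 → ℝ≥0∞} (hφ : Measurable φ) :
    ∫⁻ y, ∏ i, φ (y i) ∂(Measure.pi fun _ : Fin n => P) = (∫⁻ x, φ x ∂P) ^ n := by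
  induction n with
  | zero => simp
  | succ n ih =>
    rw [lintegral_pi_fin_succ (by fun_prop)]
    simp only [Fin.prod_univ_succ, Fin.cons_zero, Fin.cons_succ]
    have : ∀ x, ∫⁻ y, φ x * ∏ i, φ (y i) ∂(Measure.pi fun _ : Fin n => P) =
        φ x * (∫⁻ x, φ x ∂P) ^ n := fun x => by
      rw [lintegral_const_mul _ (by fun_prop), ih]
    simp only [this]
    rw [lintegral_mul_const _ hφ, pow_succ']

variable {l : 𝕏 → T → ℝ≥0∞}

theorem measurable_prod_fin (hl : Measurable (Function.uncurry l)) (n : ℕ) :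
    Measurable fun p : (Fin n → 𝕏) × T => ∏ i, l (p.1 i) p.2 :=
  Finset.measurable_prod _ fun i _ => hl.comp (f := fun p : (Fin n → 𝕏) × T => (p.1 i, p.2))
    (((measurable_pi_apply i).comp measurable_fst).prodMk measurable_snd)

theorem measurable_prod_range (hl : Measurable (Function.uncurry l)) (n : ℕ) :
    Measurable fun p : (ℕ → 𝕏) × T => ∏ i ∈ Finset.range n, l (p.1 i) p.2 :=
  Finset.measurable_prod _ fun i _ => hl.comp (f := fun p : (ℕ → 𝕏) × T => (p.1 i, p.2))
    (((measurable_pi_apply i).comp measurable_fst).prodMk measurable_snd)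

theorem measurable_lintegral_prod_range (hl : Measurable (Function.uncurry l)) (n : ℕ)
    (Q : Measure T) [SFinite Q] :
    Measurable fun ω : ℕ → 𝕏 => ∫⁻ t, ∏ i ∈ Finset.range n, l (ω i) t ∂Q :=
  (measurable_prod_range hl n).lintegral_prod_right'

/-- The expectation of an integrated product of i.i.d. terms. -/
theorem lintegral_lintegral_prod_range (hl : Measurable (Function.uncurry l)) (n : ℕ)
    (Q : Measure T) [SFinite Q] :
    ∫⁻ ω, ∫⁻ t, ∏ i ∈ Finset.range n, l (ω i) t ∂Q ∂(Measure.infinitePi fun _ : ℕ => P) =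
      ∫⁻ t, (∫⁻ x, l x t ∂P) ^ n ∂Q := by
  rw [lintegral_lintegral_swap (measurable_prod_range hl n).aemeasurable]
  refine lintegral_congr fun t => ?_
  have hlt : Measurable fun x => l x t := hl.comp measurable_prodMk_right
  simp only [Finset.prod_range]
  rw [← lintegral_pi_fin_prod n hlt]
  exact lintegral_infinitePi_fin (n := n) (g := fun y => ∏ i, l (y i) t) (by fun_prop)

/-- If every mixture of the kernel with respect to a finite measure `Q' ≪ Q` has a square root
with expectation at most `ρ * √Q'(univ)`, then the square root of the integrated product of `n`
i.i.d. terms has expectation at most `ρ ^ n * √Q(univ)`. -/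
theorem lintegral_sqrt_pi_le (hl : Measurable (Function.uncurry l)) {ρ : ℝ≥0∞} (hρ : ρ ≠ 0)
    (n : ℕ) (Q : Measure T) [IsFiniteMeasure Q]
    (h : ∀ Q' : Measure T, IsFiniteMeasure Q' → Q' ≪ Q →
      ∫⁻ x, (∫⁻ t, l x t ∂Q') ^ (1 / 2 : ℝ) ∂P ≤ ρ * Q' Set.univ ^ (1 / 2 : ℝ)) :
    ∫⁻ y, (∫⁻ t, ∏ i, l (y i) t ∂Q) ^ (1 / 2 : ℝ) ∂(Measure.pi fun _ : Fin n => P) ≤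
      ρ ^ n * Q Set.univ ^ (1 / 2 : ℝ) := by
  induction n generalizing Q with
  | zero => simp
  | succ n ih =>
    have hlx : ∀ x, Measurable (l x) := fun x => hl.comp measurable_prodMk_left
    rw [lintegral_pi_fin_succ (((measurable_prod_fin hl _).lintegral_prod_right').pow_const _)]
    simp only [Fin.prod_univ_succ, Fin.cons_zero, Fin.cons_succ]
    calc ∫⁻ x, ∫⁻ y, (∫⁻ t, l x t * ∏ i, l (y i) t ∂Q) ^ (1 / 2 : ℝ)
          ∂(Measure.pi fun _ : Fin n => P) ∂P
        ≤ ∫⁻ x, ρ ^ n * (∫⁻ t, l x t ∂Q) ^ (1 / 2 : ℝ) ∂P := by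
          refine lintegral_mono fun x => ?_
          by_cases hx : ∫⁻ t, l x t ∂Q = ∞
          · rw [hx, ENNReal.top_rpow_of_pos (by norm_num), ENNReal.mul_top (pow_ne_zero _ hρ)]
            exact le_top
          -- The factor of the first observation is absorbed into the mixing measure. This is why
          -- the induction runs over all finite measures, and absolute continuity carries the
          -- assumption over.
          have : IsFiniteMeasure (Q.withDensity (l x)) := isFiniteMeasure_withDensity hx
          have hac := withDensity_absolutelyContinuous Q (l x)
          have := ih (Q.withDensity (l x)) fun Q' hQ' hQ'' => h Q' hQ' (hQ''.trans hac)
          rw [withDensity_apply _ .univ, Measure.restrict_univ] at this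
          refine le_of_eq_of_le (lintegral_congr fun y => ?_) this
          have hm : Measurable fun t => ∏ i, l (y i) t :=
            (measurable_prod_fin hl n).comp measurable_prodMk_left
          rw [lintegral_withDensity_eq_lintegral_mul _ (hlx x) hm]
          rfl
      _ = ρ ^ n * ∫⁻ x, (∫⁻ t, l x t ∂Q) ^ (1 / 2 : ℝ) ∂P :=
          lintegral_const_mul _ (hl.lintegral_prod_right'.pow_const _)
      _ ≤ ρ ^ n * (ρ * Q Set.univ ^ (1 / 2 : ℝ)) :=
          mul_le_mul_right (h Q inferInstance .rfl) _
      _ = ρ ^ (n + 1) * Q Set.univ ^ (1 / 2 : ℝ) := by rw [pow_succ, mul_assoc]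

theorem lintegral_sqrt_infinitePi_le (hl : Measurable (Function.uncurry l)) {ρ : ℝ≥0∞}
    (hρ : ρ ≠ 0) (n : ℕ) (Q : Measure T) [IsFiniteMeasure Q]
    (h : ∀ Q' : Measure T, IsFiniteMeasure Q' → Q' ≪ Q →
      ∫⁻ x, (∫⁻ t, l x t ∂Q') ^ (1 / 2 : ℝ) ∂P ≤ ρ * Q' Set.univ ^ (1 / 2 : ℝ)) :
    ∫⁻ ω, (∫⁻ t, ∏ i ∈ Finset.range n, l (ω i) t ∂Q) ^ (1 / 2 : ℝ)
      ∂(Measure.infinitePi fun _ : ℕ => P) ≤ ρ ^ n * Q Set.univ ^ (1 / 2 : ℝ) := by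
  refine le_of_eq_of_le ?_ (lintegral_sqrt_pi_le hl hρ n Q h)
  simp only [Finset.prod_range]
  exact lintegral_infinitePi_fin (n := n)
    (g := fun y => (∫⁻ t, ∏ i, l (y i) t ∂Q) ^ (1 / 2 : ℝ))
    (((measurable_prod_fin hl _).lintegral_prod_right').pow_const _)

/-- Either `c * R ≥ 1` or `(c * R) ^ (-1 / 2) ≥ 1`, with value `∞` at zero. Integrated over a prior,
this avoids Jensen's inequality for the negative moment. -/
theorem ENNReal.one_le_mul_add_rpow {c R : ℝ≥0∞} (hc' : c ≠ ∞) (hR : R ≠ ∞) :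
    1 ≤ c * R + c ^ (-1 / 2 : ℝ) * R ^ (-1 / 2 : ℝ) := by
  rcases le_or_gt 1 (c * R) with h | h
  · exact h.trans le_self_add
  · refine le_trans ?_ le_add_self
    rw [← ENNReal.mul_rpow_of_ne_top hc' hR]
    rcases eq_or_ne (c * R) 0 with h0 | h0
    · rw [h0, ENNReal.zero_rpow_of_neg (by norm_num)]
      exact le_top
    · exact ENNReal.one_le_rpow_of_pos_of_le_one_of_neg (pos_iff_ne_zero.2 h0) h.le (by norm_num)

/-- A lower bound for an integrated product of `n` i.i.d. terms, which holds with high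
probability if the terms have negative moments of order `1/2`. -/
theorem infinitePi_lintegral_prod_lt_le (hl : Measurable (Function.uncurry l)) (n : ℕ)
    (Q : Measure T) [IsFiniteMeasure Q] (hQ : Q Set.univ ≠ 0)
    (hfin : ∀ᵐ x ∂P, ∀ t, l x t ≠ ∞) {B c : ℝ≥0∞} (hc' : c ≠ ∞)
    (hB : ∀ᵐ t ∂Q, ∫⁻ x, l x t ^ (-1 / 2 : ℝ) ∂P ≤ B) :
    (Measure.infinitePi fun _ : ℕ => P)
      {ω | c * ∫⁻ t, ∏ i ∈ Finset.range n, l (ω i) t ∂Q < Q Set.univ / 2} ≤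
      2 * c ^ (-1 / 2 : ℝ) * B ^ n := by
  have hl' : Measurable (Function.uncurry fun x t => l x t ^ (-1 / 2 : ℝ)) := hl.pow_const _
  have hQ2 : Q Set.univ / 2 ≠ 0 := by simp [hQ]
  have hQ2' : Q Set.univ / 2 ≠ ∞ := (ENNReal.div_lt_top (measure_ne_top _ _) (by simp)).ne
  have hall : ∀ᵐ ω ∂(Measure.infinitePi fun _ : ℕ => P), ∀ i, ∀ t, l (ω i) t ≠ ∞ := by
    refine ae_all_iff.2 fun i => ?_
    exact (measurePreserving_eval_infinitePi (fun _ : ℕ => P) i).quasiMeasurePreserving.ae hfin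
  have hsub : ∀ᵐ ω ∂(Measure.infinitePi fun _ : ℕ => P),
      ω ∈ {ω | c * ∫⁻ t, ∏ i ∈ Finset.range n, l (ω i) t ∂Q < Q Set.univ / 2} →
      ω ∈ {ω | Q Set.univ / 2 ≤ c ^ (-1 / 2 : ℝ) *
        ∫⁻ t, ∏ i ∈ Finset.range n, l (ω i) t ^ (-1 / 2 : ℝ) ∂Q} := by
    filter_upwards [hall] with ω hω hlt
    have h1 : Q Set.univ ≤ c * ∫⁻ t, ∏ i ∈ Finset.range n, l (ω i) t ∂Q + c ^ (-1 / 2 : ℝ) *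
        ∫⁻ t, ∏ i ∈ Finset.range n, l (ω i) t ^ (-1 / 2 : ℝ) ∂Q := by
      have hm1 : Measurable fun t => ∏ i ∈ Finset.range n, l (ω i) t :=
        (measurable_prod_range hl n).comp measurable_prodMk_left
      have hm2 : Measurable fun t => ∏ i ∈ Finset.range n, l (ω i) t ^ (-1 / 2 : ℝ) :=
        (measurable_prod_range hl' n).comp measurable_prodMk_left
      rw [← lintegral_const_mul _ hm1, ← lintegral_const_mul _ hm2,
        ← lintegral_add_left (hm1.const_mul c)]
      rw [← lintegral_one]
      refine lintegral_mono fun t => ?_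
      have hne : ∀ i ∈ Finset.range n, l (ω i) t ≠ ∞ := fun i _ => hω i t
      have h2 : ∏ i ∈ Finset.range n, l (ω i) t ^ (-1 / 2 : ℝ) =
          (∏ i ∈ Finset.range n, l (ω i) t) ^ (-1 / 2 : ℝ) :=
        ENNReal.prod_rpow_of_ne_top hne _
      rw [h2]
      exact ENNReal.one_le_mul_add_rpow hc' (ENNReal.prod_ne_top hne)
    -- The two terms sum to at least `Q Set.univ`, so they cannot both be below half of it.
    by_contra! hcon
    exact absurd (h1.trans_lt (ENNReal.add_lt_add hlt hcon)) (by rw [ENNReal.add_halves]; simp)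
  refine (measure_mono_ae hsub).trans ?_
  refine (meas_ge_le_lintegral_div
    ((measurable_lintegral_prod_range hl' n Q).const_mul _).aemeasurable hQ2 hQ2').trans ?_
  rw [lintegral_const_mul _ (measurable_lintegral_prod_range hl' n Q),
    lintegral_lintegral_prod_range hl' n Q]
  have h3 : ∫⁻ t, (∫⁻ x, l x t ^ (-1 / 2 : ℝ) ∂P) ^ n ∂Q ≤ B ^ n * Q Set.univ := by
    rw [← lintegral_const]
    refine lintegral_mono_ae ?_
    filter_upwards [hB] with t ht
    gcongr
  refine ENNReal.div_le_of_le_mul ?_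
  calc c ^ (-1 / 2 : ℝ) * ∫⁻ t, (∫⁻ x, l x t ^ (-1 / 2 : ℝ) ∂P) ^ n ∂Q
      ≤ c ^ (-1 / 2 : ℝ) * (B ^ n * Q Set.univ) := by gcongr
    _ = c ^ (-1 / 2 : ℝ) * B ^ n * (2 * (Q Set.univ / 2)) := by
        rw [ENNReal.mul_div_cancel (by simp) (by simp), mul_assoc]
    _ = 2 * c ^ (-1 / 2 : ℝ) * B ^ n * (Q Set.univ / 2) := by ring

end product

/-! ### One observation: Hellinger affinity, negative moment and mixtures. -/

section ratio

variable {𝕏 T : Type*} [MeasurableSpace 𝕏] [MeasurableSpace T] {μ : Measure 𝕏} {f₀ : 𝕏 → ℝ}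

theorem measurable_ratio {F : T → 𝕏 → ℝ} (hm : Measurable (Function.uncurry F))
    (hf₀ : Measurable f₀) :
    Measurable (Function.uncurry fun x t => ENNReal.ofReal (F t x) / ENNReal.ofReal (f₀ x)) := by
  have h1 : Measurable fun p : 𝕏 × T => F p.2 p.1 := hm.comp measurable_swap
  have h2 : Measurable fun p : 𝕏 × T => f₀ p.1 := hf₀.comp measurable_fst
  exact h1.ennreal_ofReal.div h2.ennreal_ofReal

theorem ae_ne_zero_withDensity (hf₀ : f₀ ∈ densities μ) :
    ∀ᵐ x ∂(μ.withDensity fun x => ENNReal.ofReal (f₀ x)), ENNReal.ofReal (f₀ x) ≠ 0 := by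
  rw [ae_withDensity_iff hf₀.1.ennreal_ofReal]
  exact ae_of_all _ fun x hx => hx

theorem lintegral_ratio_le_one (hf₀ : f₀ ∈ densities μ) {f : 𝕏 → ℝ} (hf : f ∈ densities μ) :
    ∫⁻ x, ENNReal.ofReal (f x) / ENNReal.ofReal (f₀ x)
      ∂(μ.withDensity fun x => ENNReal.ofReal (f₀ x)) ≤ 1 := by
  have hm : Measurable fun x => ENNReal.ofReal (f x) / ENNReal.ofReal (f₀ x) :=
    hf.1.ennreal_ofReal.div hf₀.1.ennreal_ofReal
  rw [lintegral_withDensity_eq_lintegral_mul _ hf₀.1.ennreal_ofReal hm, ← hf.2.2]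
  exact lintegral_mono fun x => ENNReal.mul_div_le

/-- One factor `√f₀` of the density of `P₀` cancels the denominator; what remains is an affinity
with respect to `μ`. -/
theorem lintegral_sqrt_div_le (hf₀ : f₀ ∈ densities μ) {g : 𝕏 → ℝ≥0∞} (hg : Measurable g) :
    ∫⁻ x, (g x / ENNReal.ofReal (f₀ x)) ^ (1 / 2 : ℝ)
      ∂(μ.withDensity fun x => ENNReal.ofReal (f₀ x)) ≤
    ∫⁻ x, g x ^ (1 / 2 : ℝ) * ENNReal.ofReal (f₀ x) ^ (1 / 2 : ℝ) ∂μ := by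
  have hm : Measurable fun x => (g x / ENNReal.ofReal (f₀ x)) ^ (1 / 2 : ℝ) :=
    (hg.div hf₀.1.ennreal_ofReal).pow_const _
  rw [lintegral_withDensity_eq_lintegral_mul _ hf₀.1.ennreal_ofReal hm]
  refine lintegral_mono fun x => ?_
  simp only [Pi.mul_apply]
  generalize hb : ENNReal.ofReal (f₀ x) = a
  have ha : a = a ^ (1 / 2 : ℝ) * a ^ (1 / 2 : ℝ) := by
    rw [← ENNReal.rpow_add_of_nonneg _ _ (by norm_num) (by norm_num)]
    norm_num
  calc a * (g x / a) ^ (1 / 2 : ℝ)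
      = a ^ (1 / 2 : ℝ) * (a ^ (1 / 2 : ℝ) * (g x / a) ^ (1 / 2 : ℝ)) := by
        rw [← mul_assoc, ← ha]
    _ = a ^ (1 / 2 : ℝ) * (a * (g x / a)) ^ (1 / 2 : ℝ) := by
        rw [ENNReal.mul_rpow_of_nonneg _ _ (by norm_num)]
    _ ≤ a ^ (1 / 2 : ℝ) * g x ^ (1 / 2 : ℝ) := by
        gcongr
        exact ENNReal.mul_div_le
    _ = _ := mul_comm _ _

/-- The Hellinger affinity of two densities. -/
theorem lintegral_sqrt_mul_sqrt_le (hf₀ : f₀ ∈ densities μ) {h : 𝕏 → ℝ} (hh : h ∈ densities μ) :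
    ∫⁻ x, ENNReal.ofReal (h x) ^ (1 / 2 : ℝ) * ENNReal.ofReal (f₀ x) ^ (1 / 2 : ℝ) ∂μ ≤
      ENNReal.ofReal (Real.exp (-(hellinger μ h f₀ ^ 2) / 2)) := by
  have hI : Integrable (fun x => √(h x) * √(f₀ x)) μ := by
    refine ((integrable_of_mem_densities hh).add (integrable_of_mem_densities hf₀)).mono'
      (hh.1.sqrt.mul hf₀.1.sqrt).aestronglyMeasurable (ae_of_all _ fun x => ?_)
    rw [Real.norm_of_nonneg (by positivity), Pi.add_apply]
    nlinarith [Real.sq_sqrt (hh.2.1 x), Real.sq_sqrt (hf₀.2.1 x), sq_nonneg (√(h x) - √(f₀ x)),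
      Real.sqrt_nonneg (h x), Real.sqrt_nonneg (f₀ x),
      mul_nonneg (Real.sqrt_nonneg (h x)) (Real.sqrt_nonneg (f₀ x))]
  have h1 : ∫⁻ x, ENNReal.ofReal (h x) ^ (1 / 2 : ℝ) * ENNReal.ofReal (f₀ x) ^ (1 / 2 : ℝ) ∂μ =
      ENNReal.ofReal (∫ x, √(h x) * √(f₀ x) ∂μ) := by
    rw [ofReal_integral_eq_lintegral_ofReal hI (ae_of_all _ fun x => by positivity)]
    refine lintegral_congr fun x => ?_
    rw [ENNReal.ofReal_mul (Real.sqrt_nonneg _), Real.sqrt_eq_rpow, Real.sqrt_eq_rpow,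
      ENNReal.ofReal_rpow_of_nonneg (hh.2.1 x) (by norm_num),
      ENNReal.ofReal_rpow_of_nonneg (hf₀.2.1 x) (by norm_num)]
  have h2 : hellinger μ h f₀ ^ 2 = 2 - 2 * ∫ x, √(h x) * √(f₀ x) ∂μ := by
    rw [hellinger_sq]
    have : (fun x => (√(h x) - √(f₀ x)) ^ 2) = fun x => h x + f₀ x - 2 * (√(h x) * √(f₀ x)) := by
      funext x
      nlinarith [Real.sq_sqrt (hh.2.1 x), Real.sq_sqrt (hf₀.2.1 x)]
    have hadd : Integrable (fun x => h x + f₀ x) μ :=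
      (integrable_of_mem_densities hh).add (integrable_of_mem_densities hf₀)
    rw [this, integral_sub hadd (hI.const_mul 2), integral_add (integrable_of_mem_densities hh)
      (integrable_of_mem_densities hf₀), integral_const_mul, integral_of_mem_densities hh,
      integral_of_mem_densities hf₀]
    norm_num
  rw [h1]
  refine ENNReal.ofReal_le_ofReal ?_
  rw [h2]
  -- The affinity is `1 - H² / 2`, which is at most `exp (-H² / 2)`.
  have := Real.add_one_le_exp (-(2 - 2 * ∫ x, √(h x) * √(f₀ x) ∂μ) / 2)
  linarith

/-- With `u = √a` and `v = √b` this is `(u - v)² (2u / (3v) + 1/3) + u² = 2u³ / (3v) + v² / 3`: the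
weights `2/3` and `1/3` make the terms in `u * v` cancel. Writing it additively avoids subtraction
in `ℝ≥0∞`, and it survives the conventions at zero. -/
theorem hellingerStar_integrand_add {a b : ℝ} (ha : 0 ≤ a) (hb : 0 ≤ b) :
    ENNReal.ofReal ((√a - √b) ^ 2) *
        (2 / 3 * (ENNReal.ofReal a / ENNReal.ofReal b) ^ (1 / 2 : ℝ) + 1 / 3) + ENNReal.ofReal a =
      2 / 3 * (ENNReal.ofReal a * (ENNReal.ofReal b / ENNReal.ofReal a) ^ (-1 / 2 : ℝ)) +
        1 / 3 * ENNReal.ofReal b := by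
  rcases ha.eq_or_lt with rfl | ha
  · simp [Real.sq_sqrt hb, mul_comm]
  have ha' : ENNReal.ofReal a ≠ 0 := by simpa using ha
  rcases hb.eq_or_lt with rfl | hb
  · rw [Real.sqrt_zero, sub_zero, Real.sq_sqrt ha.le, ENNReal.ofReal_zero, ENNReal.zero_div,
      ENNReal.div_zero ha', ENNReal.top_rpow_of_pos (by norm_num),
      ENNReal.zero_rpow_of_neg (by norm_num), ENNReal.mul_top (by simp), top_add,
      ENNReal.mul_top ha', ENNReal.mul_top (by simp), top_add, top_add]
  · have h23 : (2 / 3 : ℝ≥0∞) = ENNReal.ofReal (2 / 3) := by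
      rw [ENNReal.ofReal_div_of_pos (by norm_num)]; simp
    have h13 : (1 / 3 : ℝ≥0∞) = ENNReal.ofReal (1 / 3) := by
      rw [ENNReal.ofReal_div_of_pos (by norm_num)]; simp
    have hsa : 0 < √a := Real.sqrt_pos.2 ha
    have hsb : 0 < √b := Real.sqrt_pos.2 hb
    have e1 : (b / a) ^ (-1 / 2 : ℝ) = √a / √b := by
      rw [neg_div, Real.rpow_neg (by positivity), ← Real.sqrt_eq_rpow, Real.sqrt_div hb.le, inv_div]
    have e2 : (a / b) ^ (1 / 2 : ℝ) = √a / √b := by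
      rw [← Real.sqrt_eq_rpow, Real.sqrt_div ha.le]
    rw [← ENNReal.ofReal_div_of_pos hb, ← ENNReal.ofReal_div_of_pos ha,
      ENNReal.ofReal_rpow_of_pos (by positivity), ENNReal.ofReal_rpow_of_pos (by positivity),
      h23, h13, e1, e2, ← ENNReal.ofReal_mul (by positivity), ← ENNReal.ofReal_add (by positivity)
      (by positivity), ← ENNReal.ofReal_mul (by positivity), ← ENNReal.ofReal_add (by positivity)
      (by positivity), ← ENNReal.ofReal_mul (by positivity), ← ENNReal.ofReal_mul (by positivity),
      ← ENNReal.ofReal_mul (by positivity), ← ENNReal.ofReal_add (by positivity) (by positivity)]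
    congr 1
    have h1 := Real.sq_sqrt ha.le
    have h2 := Real.sq_sqrt hb.le
    generalize √a = u at *
    generalize √b = v at *
    subst h1 h2
    field_simp
    ring

/-- The negative moment of order `1/2` of the likelihood ratio is controlled by `H_*`. -/
theorem lintegral_ratio_rpow_le (hf₀ : f₀ ∈ densities μ) {f : 𝕏 → ℝ} (hf : f ∈ densities μ)
    {ε : ℝ} (hε : hellingerStar μ f₀ f ≤ ENNReal.ofReal ε) :
    ∫⁻ x, (ENNReal.ofReal (f x) / ENNReal.ofReal (f₀ x)) ^ (-1 / 2 : ℝ)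
      ∂(μ.withDensity fun x => ENNReal.ofReal (f₀ x)) ≤
    ENNReal.ofReal (Real.exp (3 / 2 * ε ^ 2)) := by
  have hma := hf₀.1.ennreal_ofReal
  have hmb := hf.1.ennreal_ofReal
  have hm : Measurable fun x =>
      (ENNReal.ofReal (f x) / ENNReal.ofReal (f₀ x)) ^ (-1 / 2 : ℝ) := (hmb.div hma).pow_const _
  rw [lintegral_withDensity_eq_lintegral_mul _ hma hm]
  simp only [Pi.mul_apply]
  set I := ∫⁻ x, ENNReal.ofReal (f₀ x) *
    (ENNReal.ofReal (f x) / ENNReal.ofReal (f₀ x)) ^ (-1 / 2 : ℝ) ∂μ with hI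
  set J := ∫⁻ x, ENNReal.ofReal ((√(f₀ x) - √(f x)) ^ 2) *
      (2 / 3 * (ENNReal.ofReal (f₀ x) / ENNReal.ofReal (f x)) ^ (1 / 2 : ℝ) + 1 / 3) ∂μ with hJ
  have hJle : J ≤ ENNReal.ofReal (ε ^ 2) := by
    have h1 : hellingerStar μ f₀ f = J ^ (1 / 2 : ℝ) := rfl
    rw [h1] at hε
    have h2 : J = (J ^ (1 / 2 : ℝ)) ^ 2 := by
      rw [← ENNReal.rpow_natCast, ← ENNReal.rpow_mul]; norm_num
    rw [h2]
    refine (pow_le_pow_left' hε 2).trans ?_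
    rcases le_total 0 ε with h | h
    · rw [ENNReal.ofReal_pow h]
    · rw [ENNReal.ofReal_of_nonpos h]; simp
  -- Integrating the pointwise identity gives `I = 1 + 3 / 2 * J`, whence `I ≤ 1 + 3 / 2 * ε ^ 2 ≤
  -- exp (3 / 2 * ε ^ 2)`.
  have hIJ : 2 / 3 * I + 1 / 3 = J + 1 := by
    calc 2 / 3 * I + 1 / 3
        = 2 / 3 * I + 1 / 3 * ∫⁻ x, ENNReal.ofReal (f x) ∂μ := by rw [hf.2.2, mul_one]
      _ = ∫⁻ x, (2 / 3 * (ENNReal.ofReal (f₀ x) *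
            (ENNReal.ofReal (f x) / ENNReal.ofReal (f₀ x)) ^ (-1 / 2 : ℝ)) +
            1 / 3 * ENNReal.ofReal (f x)) ∂μ := by
          have hab : Measurable fun x => ENNReal.ofReal (f₀ x) *
            (ENNReal.ofReal (f x) / ENNReal.ofReal (f₀ x)) ^ (-1 / 2 : ℝ) := hma.mul hm
          rw [lintegral_add_right _ (hmb.const_mul _), lintegral_const_mul _ hmb,
            lintegral_const_mul _ hab]
      _ = ∫⁻ x, (ENNReal.ofReal ((√(f₀ x) - √(f x)) ^ 2) *
            (2 / 3 * (ENNReal.ofReal (f₀ x) / ENNReal.ofReal (f x)) ^ (1 / 2 : ℝ) + 1 / 3) +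
            ENNReal.ofReal (f₀ x)) ∂μ :=
          lintegral_congr fun x => (hellingerStar_integrand_add (hf₀.2.1 x) (hf.2.1 x)).symm
      _ = J + 1 := by rw [lintegral_add_right _ hma, hf₀.2.2]
  have hIfin : I ≠ ∞ := by
    intro h
    rw [h, ENNReal.mul_top (by simp), top_add] at hIJ
    exact (ENNReal.add_lt_top.2 ⟨hJle.trans_lt ENNReal.ofReal_lt_top, ENNReal.one_lt_top⟩).ne
      hIJ.symm
  have hJfin : J ≠ ∞ := (hJle.trans_lt ENNReal.ofReal_lt_top).ne
  have hreal : 2 / 3 * I.toReal + 1 / 3 = J.toReal + 1 := by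
    have := congrArg ENNReal.toReal hIJ
    rw [ENNReal.toReal_add (ENNReal.mul_ne_top (by finiteness) hIfin) (by finiteness),
      ENNReal.toReal_add hJfin (by simp), ENNReal.toReal_mul] at this
    simpa using this
  have hJr : J.toReal ≤ ε ^ 2 := ENNReal.toReal_le_of_le_ofReal (sq_nonneg _) hJle
  rw [← ENNReal.ofReal_toReal hIfin]
  refine ENNReal.ofReal_le_ofReal ?_
  have := Real.add_one_le_exp (3 / 2 * ε ^ 2)
  linarith

variable {F : T → 𝕏 → ℝ} {d : (𝕏 → ℝ) → (𝕏 → ℝ) → ℝ} {s : ℝ}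

/-- A mixture of densities in a `d`-ball which is away from `f₀` has a small affinity with
`f₀`. -/
theorem IsAdmissibleDistance.lintegral_sqrt_mixture_le [SigmaFinite μ]
    (hd : IsAdmissibleDistance μ d s) (hs : 0 < s)
    (hm : Measurable (Function.uncurry F)) (hF : ∀ t, F t ∈ densities μ)
    (hf₀ : f₀ ∈ densities μ) (Q : Measure T) [IsFiniteMeasure Q] {g : 𝕏 → ℝ}
    (hg : g ∈ densities μ) {δ κ : ℝ} (hκ : 0 ≤ κ) (hQ : ∀ᵐ t ∂Q, d (F t) g ≤ δ)
    (hsep : ∀ h ∈ densities μ, d h g ≤ δ → κ ≤ d h f₀) :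
    ∫⁻ x, (∫⁻ t, ENNReal.ofReal (F t x) / ENNReal.ofReal (f₀ x) ∂Q) ^ (1 / 2 : ℝ)
      ∂(μ.withDensity fun x => ENNReal.ofReal (f₀ x)) ≤
    ENNReal.ofReal (Real.exp (-(κ ^ 2) / 2)) * Q Set.univ ^ (1 / 2 : ℝ) := by
  rcases eq_or_ne Q 0 with rfl | hQ0
  · simp
  have hne : NeZero Q := ⟨hQ0⟩
  set m := Q Set.univ with hmdef
  have hm0 : m ≠ 0 := by simpa [hmdef] using hQ0
  have hmt : m ≠ ∞ := measure_ne_top _ _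
  -- Jensen's inequality needs a probability measure, so `Q` is normalised; its mass returns as the
  -- factor `m ^ (1 / 2)`.
  obtain ⟨h, hh, hle, hae⟩ := hd.exists_mixture hs hm hF (m⁻¹ • Q) hg
    (Measure.ae_smul_measure hQ _)
  have hmix : (fun x => ∫⁻ t, ENNReal.ofReal (F t x) ∂Q) =ᵐ[μ]
      fun x => m * ENNReal.ofReal (h x) := by
    filter_upwards [hae] with x hx
    rw [hx, lintegral_smul_measure, smul_eq_mul, ← mul_assoc, ENNReal.mul_inv_cancel hm0 hmt,
      one_mul]
  have hmeas : Measurable fun x => ∫⁻ t, ENNReal.ofReal (F t x) ∂Q := by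
    have h1 : Measurable fun p : 𝕏 × T => ENNReal.ofReal (F p.2 p.1) :=
      (hm.comp measurable_swap).ennreal_ofReal
    exact h1.lintegral_prod_right'
  have hdiv : ∀ x, ∫⁻ t, ENNReal.ofReal (F t x) / ENNReal.ofReal (f₀ x) ∂Q =
      (∫⁻ t, ENNReal.ofReal (F t x) ∂Q) / ENNReal.ofReal (f₀ x) := fun x => by
    simp only [div_eq_mul_inv]
    exact lintegral_mul_const _ (hm.comp measurable_prodMk_right).ennreal_ofReal
  simp only [hdiv]
  refine (lintegral_sqrt_div_le hf₀ hmeas).trans ?_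
  calc ∫⁻ x, (∫⁻ t, ENNReal.ofReal (F t x) ∂Q) ^ (1 / 2 : ℝ) *
        ENNReal.ofReal (f₀ x) ^ (1 / 2 : ℝ) ∂μ
      = ∫⁻ x, m ^ (1 / 2 : ℝ) * (ENNReal.ofReal (h x) ^ (1 / 2 : ℝ) *
        ENNReal.ofReal (f₀ x) ^ (1 / 2 : ℝ)) ∂μ := by
        refine lintegral_congr_ae ?_
        filter_upwards [hmix] with x hx
        rw [hx, ENNReal.mul_rpow_of_nonneg _ _ (by norm_num), mul_assoc]
    _ = m ^ (1 / 2 : ℝ) * ∫⁻ x, (ENNReal.ofReal (h x) ^ (1 / 2 : ℝ) *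
        ENNReal.ofReal (f₀ x) ^ (1 / 2 : ℝ)) ∂μ :=
        lintegral_const_mul _ ((hh.1.ennreal_ofReal.pow_const _).mul
          (hf₀.1.ennreal_ofReal.pow_const _))
    _ ≤ m ^ (1 / 2 : ℝ) * ENNReal.ofReal (Real.exp (-(κ ^ 2) / 2)) := by
        gcongr
        refine (lintegral_sqrt_mul_sqrt_le hf₀ hh).trans (ENNReal.ofReal_le_ofReal ?_)
        have h1 := (hsep h hh hle).trans (hd.le_hellinger h hh f₀ hf₀)
        gcongr
    _ = _ := mul_comm _ _

end ratio

/-! ### The integrated likelihood ratio: lower bound, shells and the far region. -/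

theorem ENNReal.rpow_half_tsum_le {ι : Type*} (a : ι → ℝ≥0∞) :
    (∑' i, a i) ^ (1 / 2 : ℝ) ≤ ∑' i, a i ^ (1 / 2 : ℝ) := by
  have h2 : ∀ x : ℝ≥0∞, (x ^ (2 : ℝ)) ^ (1 / 2 : ℝ) = x := fun x => by
    rw [← ENNReal.rpow_mul]; norm_num
  have h1 : ∀ x : ℝ≥0∞, (x ^ (1 / 2 : ℝ)) ^ (2 : ℝ) = x := fun x => by
    rw [← ENNReal.rpow_mul]; norm_num
  rw [← h2 (∑' i, a i ^ (1 / 2 : ℝ))]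
  refine ENNReal.rpow_le_rpow ?_ (by norm_num)
  rw [ENNReal.tsum_eq_iSup_sum]
  refine iSup_le fun s => ?_
  rw [← h1 (∑ i ∈ s, a i)]
  refine ENNReal.rpow_le_rpow ?_ (by norm_num)
  refine le_trans ?_ (ENNReal.sum_le_tsum s)
  exact Finset.le_sum_of_subadditive (fun x : ℝ≥0∞ => x ^ (1 / 2 : ℝ))
    (ENNReal.zero_rpow_of_pos (by norm_num : (0 : ℝ) < 1 / 2)).le
    (fun x y => ENNReal.rpow_add_le_add_rpow x y (by norm_num) (by norm_num)) s a

section family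

variable {𝕏 T : Type*} [MeasurableSpace 𝕏] [MeasurableSpace T] {μ : Measure 𝕏}
  {P₀ : Measure 𝕏} {f₀ : 𝕏 → ℝ} {F : T → 𝕏 → ℝ}
  {d : (𝕏 → ℝ) → (𝕏 → ℝ) → ℝ} {s : ℝ}

theorem measurable_lintegral_likelihoodRatio (hf₀ : f₀ ∈ densities μ)
    (hm : Measurable (Function.uncurry F)) (n : ℕ) (Q : Measure T) [SFinite Q] :
    Measurable fun ω : ℕ → 𝕏 => ∫⁻ t, likelihoodRatio f₀ (F t) n ω ∂Q :=
  measurable_lintegral_prod_range (measurable_ratio hm hf₀.1) n Q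

theorem lintegral_lintegral_likelihoodRatio_le [IsProbabilityMeasure P₀] (hf₀ : f₀ ∈ densities μ)
    (hP₀ : P₀ = μ.withDensity fun x => ENNReal.ofReal (f₀ x))
    (hm : Measurable (Function.uncurry F)) (hF : ∀ t, F t ∈ densities μ) (n : ℕ)
    (Q : Measure T) [SFinite Q] :
    ∫⁻ ω, ∫⁻ t, likelihoodRatio f₀ (F t) n ω ∂Q ∂(Measure.infinitePi fun _ : ℕ => P₀) ≤
      Q Set.univ := by
  refine (lintegral_lintegral_prod_range (P := P₀) (measurable_ratio hm hf₀.1) n Q).trans_le ?_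
  rw [← lintegral_one]
  refine lintegral_mono fun t => ?_
  rw [hP₀]
  exact pow_le_one' (lintegral_ratio_le_one hf₀ (hF t)) n

theorem measurable_hellingerStar [SigmaFinite μ] (hf₀ : f₀ ∈ densities μ)
    (hm : Measurable (Function.uncurry F)) : Measurable fun t => hellingerStar μ f₀ (F t) := by
  have h2 : Measurable fun p : T × 𝕏 => f₀ p.2 := hf₀.1.comp measurable_snd
  have h3 : Measurable fun p : T × 𝕏 => ENNReal.ofReal ((√(f₀ p.2) - √(F p.1 p.2)) ^ 2) *
      (2 / 3 * (ENNReal.ofReal (f₀ p.2) / ENNReal.ofReal (F p.1 p.2)) ^ (1 / 2 : ℝ) + 1 / 3) :=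
    ((h2.sqrt.sub hm.sqrt).pow_const 2).ennreal_ofReal.mul
      ((((h2.ennreal_ofReal.div hm.ennreal_ofReal).pow_const _).const_mul _).add_const _)
  exact h3.lintegral_prod_right'.pow_const _

/-- A lower bound for the integrated likelihood ratio, with high probability. -/
theorem infinitePi_lintegral_likelihoodRatio_lt_le [SigmaFinite μ] [IsProbabilityMeasure P₀]
    (hf₀ : f₀ ∈ densities μ)
    (hP₀ : P₀ = μ.withDensity fun x => ENNReal.ofReal (f₀ x))
    (hm : Measurable (Function.uncurry F)) (hF : ∀ t, F t ∈ densities μ) (n : ℕ)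
    (Q : Measure T) [IsFiniteMeasure Q] {a : ℝ} (C : ℝ)
    (hQ : ENNReal.ofReal (Real.exp (-(n * a ^ 2))) ≤
      Q {t | hellingerStar μ f₀ (F t) ≤ ENNReal.ofReal a}) :
    (Measure.infinitePi fun _ : ℕ => P₀) {ω | ∫⁻ t, likelihoodRatio f₀ (F t) n ω ∂Q <
      ENNReal.ofReal (Real.exp (-((4 + 2 * C) * n * a ^ 2)) / 2)} ≤
      ENNReal.ofReal (2 * Real.exp (-(C * n * a ^ 2))) := by
  set W := {t | hellingerStar μ f₀ (F t) ≤ ENNReal.ofReal a} with hW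
  have hWm : MeasurableSet W := measurable_hellingerStar hf₀ hm measurableSet_Iic
  have hpos : 0 < Q W := lt_of_lt_of_le (ENNReal.ofReal_pos.2 (Real.exp_pos _)) hQ
  -- Chosen so that `c ^ (-1 / 2)` cancels the `n`-th power of the moment bound up to `exp (-(C * n
  -- * a ^ 2))`. Dividing half the prior mass by `c` then produces the exponent `4 + 2 * C`.
  set c := ENNReal.ofReal (Real.exp ((3 + 2 * C) * n * a ^ 2)) with hc
  have key := infinitePi_lintegral_prod_lt_le (P := P₀) (measurable_ratio hm hf₀.1) n
    (Q.restrict W) (by simpa using hpos.ne') (c := c)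
    (B := ENNReal.ofReal (Real.exp (3 / 2 * a ^ 2))) (by
      rw [hP₀]
      filter_upwards [ae_ne_zero_withDensity hf₀] with x hx t
      exact (ENNReal.div_lt_top ENNReal.ofReal_ne_top hx).ne) ENNReal.ofReal_ne_top (by
      filter_upwards [ae_restrict_mem hWm] with t ht
      rw [hP₀]
      exact lintegral_ratio_rpow_le hf₀ (hF t) ht)
  rw [Measure.restrict_apply_univ] at key
  refine (measure_mono fun ω hω => ?_).trans (key.trans (le_of_eq ?_))
  · have hω' : ∫⁻ t, likelihoodRatio f₀ (F t) n ω ∂Q <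
      ENNReal.ofReal (Real.exp (-((4 + 2 * C) * n * a ^ 2)) / 2) := hω
    change c * ∫⁻ t in W, likelihoodRatio f₀ (F t) n ω ∂Q < Q W / 2
    calc c * ∫⁻ t in W, likelihoodRatio f₀ (F t) n ω ∂Q
        ≤ c * ∫⁻ t, likelihoodRatio f₀ (F t) n ω ∂Q := by
          gcongr; exact Measure.restrict_le_self
      _ < c * ENNReal.ofReal (Real.exp (-((4 + 2 * C) * n * a ^ 2)) / 2) :=
          (ENNReal.mul_lt_mul_iff_right (by simp [Real.exp_pos]) ENNReal.ofReal_ne_top).2 hω'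
      _ = ENNReal.ofReal (Real.exp (-(n * a ^ 2))) / 2 := by
          rw [hc, ← ENNReal.ofReal_mul (Real.exp_pos _).le, ← mul_div_assoc, ← Real.exp_add,
            ENNReal.ofReal_div_of_pos (by norm_num), ENNReal.ofReal_ofNat]
          congr 3
          ring
      _ ≤ Q W / 2 := by gcongr
  · rw [hc, ENNReal.ofReal_rpow_of_pos (Real.exp_pos _), ← ENNReal.ofReal_pow (Real.exp_pos _).le,
      ← ENNReal.ofReal_ofNat, ← ENNReal.ofReal_mul (by norm_num),
      ← ENNReal.ofReal_mul (by positivity), ← Real.exp_mul, ← Real.exp_nat_mul, mul_assoc,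
      ← Real.exp_add]
    congr 3
    ring

theorem lintegral_sqrt_iUnion_le (hf₀ : f₀ ∈ densities μ)
    (hm : Measurable (Function.uncurry F)) (n : ℕ)
    (Q : Measure T) [SFinite Q] {ι : Type*} [Countable ι] {A : ι → Set T} {B : Set T}
    (hB : B ⊆ ⋃ i, A i) :
    ∫⁻ ω, (∫⁻ t in B, likelihoodRatio f₀ (F t) n ω ∂Q) ^ (1 / 2 : ℝ)
      ∂(Measure.infinitePi fun _ : ℕ => P₀) ≤
    ∑' i, ∫⁻ ω, (∫⁻ t in A i, likelihoodRatio f₀ (F t) n ω ∂Q) ^ (1 / 2 : ℝ)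
      ∂(Measure.infinitePi fun _ : ℕ => P₀) := by
  rw [← lintegral_tsum fun i =>
    ((measurable_lintegral_likelihoodRatio hf₀ hm n (Q.restrict (A i))).pow_const _).aemeasurable]
  refine lintegral_mono fun ω => ?_
  refine le_trans (ENNReal.rpow_le_rpow ?_ (by norm_num)) (ENNReal.rpow_half_tsum_le _)
  exact (lintegral_mono_set hB).trans (lintegral_iUnion_le _ _)

/-- The integrated likelihood ratio over a set of densities whose distance from `f₀` is of order
`η` is small, if the set has small covering numbers. -/
theorem IsAdmissibleDistance.lintegral_sqrt_shell_le [SigmaFinite μ] [IsProbabilityMeasure P₀]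
    (hd : IsAdmissibleDistance μ d s)
    (hs : 0 < s) (hf₀ : f₀ ∈ densities μ)
    (hP₀ : P₀ = μ.withDensity fun x => ENNReal.ofReal (f₀ x))
    (hm : Measurable (Function.uncurry F)) (hF : ∀ t, F t ∈ densities μ) (n : ℕ)
    (Q : Measure T) [IsProbabilityMeasure Q] {η E : ℝ} (hη : 0 ≤ η)
    (hcov : ∃ S : Finset (𝕏 → ℝ), (∀ g ∈ S, g ∈ densities μ) ∧
      (∀ t, d f₀ (F t) ≤ 2 * η → ∃ g ∈ S, d (F t) g < η / 3) ∧
      (S.card : ℝ≥0∞) ≤ ENNReal.ofReal (Real.exp E)) :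
    ∫⁻ ω, (∫⁻ t in {t | η ≤ d f₀ (F t) ∧ d f₀ (F t) ≤ 2 * η}, likelihoodRatio f₀ (F t) n ω ∂Q) ^
        (1 / 2 : ℝ) ∂(Measure.infinitePi fun _ : ℕ => P₀) ≤
      ENNReal.ofReal (Real.exp (E - n * η ^ 2 / 18)) := by
  obtain ⟨S, hS, hcov, hcard⟩ := hcov
  let A : S → Set T := fun g => {t | η ≤ d f₀ (F t) ∧ d (F t) g < η / 3}
  have hsub : {t | η ≤ d f₀ (F t) ∧ d f₀ (F t) ≤ 2 * η} ⊆ ⋃ g, A g := by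
    rintro t ⟨h1, h2⟩
    obtain ⟨g, hg, hlt⟩ := hcov t h2
    exact Set.mem_iUnion.2 ⟨⟨g, hg⟩, h1, hlt⟩
  refine (lintegral_sqrt_iUnion_le hf₀ hm n Q hsub).trans ?_
  have hone : ∀ g : S, ∫⁻ ω, (∫⁻ t in A g, likelihoodRatio f₀ (F t) n ω ∂Q) ^ (1 / 2 : ℝ)
      ∂(Measure.infinitePi fun _ : ℕ => P₀) ≤ ENNReal.ofReal (Real.exp (-(n * η ^ 2 / 18))) := by
    intro g
    have hg := hS g g.2
    rcases (A g).eq_empty_or_nonempty with h0 | ⟨t₀, ht₀, ht₀'⟩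
    · simp [h0]
    -- Enlarging `A g` to the closed ball gives a measurable set to which Jensen's inequality
    -- applies; the point `t₀` is only used to locate the ball.
    let B : Set T := {t | d (F t) g ≤ η / 3}
    have hB : MeasurableSet B := hd.measurableSet_le hm hF hg _
    have hAB : A g ⊆ B := fun t ht => ht.2.le
    have hQB : ∀ᵐ t ∂(Q.restrict B), d (F t) g ≤ η / 3 := ae_restrict_mem hB
    -- From `f₀` to `F t₀` the distance is at least `η`, while from `h` through `g` to `F t₀` it is
    -- at most `2 * η / 3`. The remaining `η / 3` gives the rate `(η / 3) ^ 2 / 2 = η ^ 2 / 18`.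
    have hsep : ∀ h ∈ densities μ, d h g ≤ η / 3 → η / 3 ≤ d h f₀ := by
      intro h hh hle
      have h1 := hd.triangle f₀ hf₀ h hh (F t₀) (hF t₀)
      have h2 := hd.triangle h hh g hg (F t₀) (hF t₀)
      rw [hd.symm g hg _ (hF t₀)] at h2
      rw [hd.symm h hh f₀ hf₀]
      linarith
    have key := lintegral_sqrt_infinitePi_le (P := P₀) (measurable_ratio hm hf₀.1)
      (ρ := ENNReal.ofReal (Real.exp (-((η / 3) ^ 2) / 2))) (by simp [Real.exp_pos]) n
      (Q.restrict B) fun Q' hQ' hac => by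
        rw [hP₀]
        exact hd.lintegral_sqrt_mixture_le hs hm hF hf₀ Q' hg (by positivity) (hac hQB) hsep
    calc ∫⁻ ω, (∫⁻ t in A g, likelihoodRatio f₀ (F t) n ω ∂Q) ^ (1 / 2 : ℝ)
          ∂(Measure.infinitePi fun _ : ℕ => P₀)
        ≤ ∫⁻ ω, (∫⁻ t in B, likelihoodRatio f₀ (F t) n ω ∂Q) ^ (1 / 2 : ℝ)
          ∂(Measure.infinitePi fun _ : ℕ => P₀) :=
          lintegral_mono fun ω => ENNReal.rpow_le_rpow (lintegral_mono_set hAB) (by norm_num)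
      _ ≤ ENNReal.ofReal (Real.exp (-((η / 3) ^ 2) / 2)) ^ n *
          (Q.restrict B) Set.univ ^ (1 / 2 : ℝ) := key
      _ ≤ ENNReal.ofReal (Real.exp (-((η / 3) ^ 2) / 2)) ^ n * 1 := by
          gcongr
          exact ENNReal.rpow_le_one ((Measure.restrict_apply_univ B).trans_le prob_le_one)
            (by norm_num)
      _ = ENNReal.ofReal (Real.exp (-(n * η ^ 2 / 18))) := by
          rw [mul_one, ← ENNReal.ofReal_pow (Real.exp_pos _).le, ← Real.exp_nat_mul]
          congr 2
          ring
  calc ∑' g : S, ∫⁻ ω, (∫⁻ t in A g, likelihoodRatio f₀ (F t) n ω ∂Q) ^ (1 / 2 : ℝ)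
        ∂(Measure.infinitePi fun _ : ℕ => P₀)
      ≤ ∑' _ : S, ENNReal.ofReal (Real.exp (-(n * η ^ 2 / 18))) := ENNReal.tsum_le_tsum hone
    _ = S.card * ENNReal.ofReal (Real.exp (-(n * η ^ 2 / 18))) := by
        rw [tsum_fintype, Finset.sum_const, Finset.card_univ, Fintype.card_coe, nsmul_eq_mul]
    _ ≤ ENNReal.ofReal (Real.exp E) * ENNReal.ofReal (Real.exp (-(n * η ^ 2 / 18))) := by gcongr
    _ = ENNReal.ofReal (Real.exp (E - n * η ^ 2 / 18)) := by
        rw [← ENNReal.ofReal_mul (Real.exp_pos _).le, ← Real.exp_add, sub_eq_add_neg]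

/-- On the shell of index `j` the decay is `q ^ (4 ^ j) ≤ q * q ^ j` with `q ≤ 1 / 2`, while the
entropy bound does not grow with `j`; the geometric series costs a factor `2`. -/
theorem IsAdmissibleDistance.lintegral_sqrt_far_le [SigmaFinite μ] [IsProbabilityMeasure P₀]
    (hd : IsAdmissibleDistance μ d s)
    (hs : 0 < s) (hf₀ : f₀ ∈ densities μ)
    (hP₀ : P₀ = μ.withDensity fun x => ENNReal.ofReal (f₀ x))
    (hm : Measurable (Function.uncurry F)) (hF : ∀ t, F t ∈ densities μ) (n : ℕ)
    (Q : Measure T) [IsProbabilityMeasure Q] {ρ E : ℝ} (hρ : 0 < ρ)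
    (hsmall : Real.exp (-(n * ρ ^ 2 / 18)) ≤ 1 / 2)
    (hcov : ∀ η, ρ ≤ η → ∃ S : Finset (𝕏 → ℝ), (∀ g ∈ S, g ∈ densities μ) ∧
      (∀ t, d f₀ (F t) ≤ 2 * η → ∃ g ∈ S, d (F t) g < η / 3) ∧
      (S.card : ℝ≥0∞) ≤ ENNReal.ofReal (Real.exp E)) :
    ∫⁻ ω, (∫⁻ t in {t | d f₀ (F t) ≤ ρ}ᶜ, likelihoodRatio f₀ (F t) n ω ∂Q) ^
        (1 / 2 : ℝ) ∂(Measure.infinitePi fun _ : ℕ => P₀) ≤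
      ENNReal.ofReal (2 * Real.exp (E - n * ρ ^ 2 / 18)) := by
  let A : ℕ → Set T := fun j => {t | 2 ^ j * ρ ≤ d f₀ (F t) ∧ d f₀ (F t) ≤ 2 * (2 ^ j * ρ)}
  have hsub : {t | d f₀ (F t) ≤ ρ}ᶜ ⊆ ⋃ j, A j := by
    intro t ht
    have ht' : ρ < d f₀ (F t) := not_le.1 ht
    obtain ⟨j, h1, h2⟩ := exists_nat_pow_near (x := d f₀ (F t) / ρ) (y := 2)
      ((one_le_div hρ).2 ht'.le) (by norm_num)
    rw [le_div_iff₀ hρ] at h1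
    rw [div_lt_iff₀ hρ, pow_succ'] at h2
    exact Set.mem_iUnion.2 ⟨j, h1, by linarith⟩
  refine (lintegral_sqrt_iUnion_le hf₀ hm n Q hsub).trans ?_
  set q := Real.exp (-(n * ρ ^ 2 / 18)) with hq
  have hone : ∀ j, ∫⁻ ω, (∫⁻ t in A j, likelihoodRatio f₀ (F t) n ω ∂Q) ^ (1 / 2 : ℝ)
      ∂(Measure.infinitePi fun _ : ℕ => P₀) ≤
        ENNReal.ofReal (Real.exp (E - n * ρ ^ 2 / 18) * (1 / 2) ^ j) := by
    intro j
    have hpow : (1 : ℝ) ≤ 2 ^ j := one_le_pow₀ (by norm_num)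
    refine (hd.lintegral_sqrt_shell_le hs hf₀ hP₀ hm hF n Q (by positivity)
      (hcov _ (le_mul_of_one_le_left hρ.le hpow))).trans (ENNReal.ofReal_le_ofReal ?_)
    calc Real.exp (E - n * (2 ^ j * ρ) ^ 2 / 18)
        ≤ Real.exp (E - n * ρ ^ 2 / 18 + j * -(n * ρ ^ 2 / 18)) := by
          refine Real.exp_le_exp.2 ?_
          -- Bernoulli's inequality for `4 ^ j = (1 + 3) ^ j`.
          have h4 : (1 : ℝ) + j ≤ (2 ^ j) ^ 2 := by
            have := one_add_mul_le_pow (a := (3 : ℝ)) (by norm_num) j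
            rw [← pow_mul, mul_comm j 2, pow_mul]
            norm_num at this ⊢
            have hj : (0 : ℝ) ≤ j := Nat.cast_nonneg j
            linarith
          have := mul_le_mul_of_nonneg_right h4 (by positivity : 0 ≤ n * ρ ^ 2 / 18)
          nlinarith
      _ = Real.exp (E - n * ρ ^ 2 / 18) * q ^ j := by
          rw [Real.exp_add, hq, ← Real.exp_nat_mul]
      _ ≤ _ := by gcongr
  refine (ENNReal.tsum_le_tsum hone).trans (le_of_eq ?_)
  rw [← ENNReal.ofReal_tsum_of_nonneg (fun j => by positivity)
    (summable_geometric_two.mul_left _), tsum_mul_left, tsum_geometric_two, mul_comm]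

end family

/-! ### Borel–Cantelli, finite covers, and the near–far split. -/

theorem ae_eventually_notMem_of_eventually_le {Ω : Type*} [MeasurableSpace Ω] {ν : Measure Ω}
    [IsProbabilityMeasure ν] {A : ℕ → Set Ω} {u : ℕ → ℝ} (hu : Summable u)
    (h : ∀ᶠ n in atTop, ν (A n) ≤ ENNReal.ofReal (u n)) :
    ∀ᵐ ω ∂ν, ∀ᶠ n in atTop, ω ∉ A n := by
  obtain ⟨N, hN⟩ := eventually_atTop.1 h
  have h1 : ∑' n, ν (if N ≤ n then A n else ∅) ≠ ∞ := by
    refine ((ENNReal.tsum_le_tsum fun n => ?_).trans_lt hu.tsum_ofReal_lt_top).ne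
    split_ifs with hn
    · exact hN n hn
    · simp
  filter_upwards [ae_eventually_notMem h1] with ω hω
  filter_upwards [hω, eventually_ge_atTop N] with n hn hn'
  rwa [if_pos hn'] at hn

/-- A finite bound excludes the value `⊤`, and an infimum over a nonempty family in `ℕ∞` is
attained. -/
theorem exists_cover_of_coveringNumber_le {𝕏 : Type*} [MeasurableSpace 𝕏] {μ : Measure 𝕏}
    {d : (𝕏 → ℝ) → (𝕏 → ℝ) → ℝ} {δ x : ℝ} {A : Set (𝕏 → ℝ)}
    (h : (coveringNumber μ d δ A : ℝ≥0∞) ≤ ENNReal.ofReal x) :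
    ∃ S : Finset (𝕏 → ℝ), (∀ g ∈ S, g ∈ densities μ) ∧ (∀ f ∈ A, ∃ g ∈ S, d f g < δ) ∧
      (S.card : ℝ≥0∞) ≤ ENNReal.ofReal x := by
  rw [coveringNumber, iInf_subtype'] at h
  rcases isEmpty_or_nonempty {S : Finset (𝕏 → ℝ) //
    (∀ g ∈ S, g ∈ densities μ) ∧ ∀ f ∈ A, ∃ g ∈ S, d f g < δ} with hemp | hne
  · simp at h
  · obtain ⟨S, hS⟩ := ENat.exists_eq_iInf fun S : {S : Finset (𝕏 → ℝ) //
      (∀ g ∈ S, g ∈ densities μ) ∧ ∀ f ∈ A, ∃ g ∈ S, d f g < δ} => (S.1.card : ℕ∞)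
    rw [← hS] at h
    exact ⟨S.1, S.2.1, S.2.2, by simpa using h⟩

/-- An upper bound for the weighted integrated likelihood ratio, with high probability. -/
theorem IsAdmissibleDistance.infinitePi_lt_mul_lintegral_likelihoodRatio_le
    {𝕏 T : Type*} [MeasurableSpace 𝕏] [MeasurableSpace T] {μ : Measure 𝕏} [SigmaFinite μ]
    {P₀ : Measure 𝕏} [IsProbabilityMeasure P₀] {f₀ : 𝕏 → ℝ} {F : T → 𝕏 → ℝ}
    {d : (𝕏 → ℝ) → (𝕏 → ℝ) → ℝ} {s : ℝ} (hd : IsAdmissibleDistance μ d s)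
    (hs : 0 < s) (hf₀ : f₀ ∈ densities μ)
    (hP₀ : P₀ = μ.withDensity fun x => ENNReal.ofReal (f₀ x))
    (hm : Measurable (Function.uncurry F)) (hF : ∀ t, F t ∈ densities μ) (n : ℕ)
    (Q : Measure T) [IsProbabilityMeasure Q] {w : ℝ≥0∞} {a b C G K r δ : ℝ}
    (ha : 0 < a) (hab : a ≤ b) (hC : 0 < C) (hG : 0 < G) (hr : 700 * (2 * C + G + 2) < r)
    (hK : 0 ≤ K) (hδ : 0 < δ) (hsmall : Real.exp (-(n * (r * b) ^ 2 / 18)) ≤ 1 / 2)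
    (hcov : ∀ η, r * b ≤ η → ∃ S : Finset (𝕏 → ℝ), (∀ g ∈ S, g ∈ densities μ) ∧
      (∀ t, d f₀ (F t) ≤ 2 * η → ∃ g ∈ S, d (F t) g < η / 3) ∧
      (S.card : ℝ≥0∞) ≤ ENNReal.ofReal (Real.exp (G * n * b ^ 2)))
    (hw : w ≤ ENNReal.ofReal (Real.exp (n * b ^ 2)))
    (hnear : w * Q {t | d f₀ (F t) ≤ r * b} ≤
      ENNReal.ofReal (K * Real.exp (-((4 + 3 * C) * n * a ^ 2)))) :
    (Measure.infinitePi fun _ : ℕ => P₀)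
      {ω | ENNReal.ofReal (δ * Real.exp (-((4 + 2 * C) * n * a ^ 2))) <
        w * ∫⁻ t, likelihoodRatio f₀ (F t) n ω ∂Q} ≤
      ENNReal.ofReal ((2 * K / δ + 2 * √(2 / δ)) * Real.exp (-(C * n * a ^ 2))) := by
  set A : Set T := {t | d f₀ (F t) ≤ r * b} with hA
  have hAm : MeasurableSet A := by
    convert hd.measurableSet_le hm hF hf₀ (r * b) using 1
    ext t
    rw [hA, Set.mem_ofPred_eq, Set.mem_ofPred_eq, hd.symm f₀ hf₀ _ (hF t)]
  have hr0 : 0 < r := by linarith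
  have hb : 0 < b := ha.trans_le hab
  set L := Real.exp (-((4 + 2 * C) * n * a ^ 2)) with hL
  have hL0 : 0 < L := Real.exp_pos _
  -- As the weight is at most `exp (n * b ^ 2)`, a far part below `m` contributes at most `δ / 2 *
  -- L`. The far estimate concerns a half moment, hence the threshold `√m`.
  set m := δ / 2 * L * Real.exp (-(n * b ^ 2)) with hmdef
  have hm0 : 0 < m := by positivity
  have hsub : {ω | ENNReal.ofReal (δ * L) < w * ∫⁻ t, likelihoodRatio f₀ (F t) n ω ∂Q} ⊆
      {ω | ENNReal.ofReal (δ / 2 * L) ≤ w * ∫⁻ t in A, likelihoodRatio f₀ (F t) n ω ∂Q} ∪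
      {ω | ENNReal.ofReal (√m) ≤
        (∫⁻ t in Aᶜ, likelihoodRatio f₀ (F t) n ω ∂Q) ^ (1 / 2 : ℝ)} := by
    intro ω hω
    by_contra hcon
    rw [Set.mem_union, not_or] at hcon
    have h1 : w * ∫⁻ t in A, likelihoodRatio f₀ (F t) n ω ∂Q < ENNReal.ofReal (δ / 2 * L) :=
      not_le.1 hcon.1
    have h2 : (∫⁻ t in Aᶜ, likelihoodRatio f₀ (F t) n ω ∂Q) ^ (1 / 2 : ℝ) <
      ENNReal.ofReal (√m) := not_le.1 hcon.2
    rw [Real.sqrt_eq_rpow, ← ENNReal.ofReal_rpow_of_pos hm0,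
      ENNReal.rpow_lt_rpow_iff (by norm_num)] at h2
    have h3 : w * ∫⁻ t in Aᶜ, likelihoodRatio f₀ (F t) n ω ∂Q ≤ ENNReal.ofReal (δ / 2 * L) := by
      refine (mul_le_mul' hw h2.le).trans (le_of_eq ?_)
      rw [← ENNReal.ofReal_mul (Real.exp_pos _).le, hmdef, mul_comm, mul_assoc, ← Real.exp_add,
        neg_add_cancel, Real.exp_zero, mul_one]
    have h4 : ENNReal.ofReal (δ * L) < w * ∫⁻ t, likelihoodRatio f₀ (F t) n ω ∂Q := hω
    rw [← lintegral_add_compl _ hAm, mul_add] at h4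
    have h5 := h4.trans_le (add_le_add h1.le h3)
    rw [← ENNReal.ofReal_add (by positivity) (by positivity)] at h5
    refine absurd h5 (not_lt.2 (le_of_eq ?_))
    congr 1
    ring
  have hnear' : (Measure.infinitePi fun _ : ℕ => P₀)
      {ω | ENNReal.ofReal (δ / 2 * L) ≤ w * ∫⁻ t in A, likelihoodRatio f₀ (F t) n ω ∂Q} ≤
      ENNReal.ofReal (2 * K / δ * Real.exp (-(C * n * a ^ 2))) := by
    have hmeas := measurable_lintegral_likelihoodRatio hf₀ hm n (Q.restrict A)
    refine (meas_ge_le_lintegral_div (hmeas.const_mul w).aemeasurable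
      (by simpa using by positivity) ENNReal.ofReal_ne_top).trans ?_
    refine ENNReal.div_le_of_le_mul ?_
    rw [lintegral_const_mul _ hmeas]
    have h1 := lintegral_lintegral_likelihoodRatio_le (P₀ := P₀) hf₀ hP₀ hm hF n (Q.restrict A)
    rw [Measure.restrict_apply_univ] at h1
    refine (mul_le_mul_right h1 w).trans (hnear.trans (le_of_eq ?_))
    rw [← ENNReal.ofReal_mul (by positivity)]
    congr 1
    -- The surplus `C` in the near-mass exponent is exactly the probability bound left after
    -- Markov's inequality at level `δ / 2 * L`.
    have : Real.exp (-((4 + 3 * C) * n * a ^ 2)) = Real.exp (-(C * n * a ^ 2)) * L := by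
      rw [hL, ← Real.exp_add]; congr 1; ring
    rw [this]
    field_simp
  have hfar' : (Measure.infinitePi fun _ : ℕ => P₀)
      {ω | ENNReal.ofReal (√m) ≤
        (∫⁻ t in Aᶜ, likelihoodRatio f₀ (F t) n ω ∂Q) ^ (1 / 2 : ℝ)} ≤
      ENNReal.ofReal (2 * √(2 / δ) * Real.exp (-(C * n * a ^ 2))) := by
    have hmeas := measurable_lintegral_likelihoodRatio hf₀ hm n (Q.restrict Aᶜ)
    refine (meas_ge_le_lintegral_div (hmeas.pow_const _).aemeasurable
      (by simpa using by positivity) ENNReal.ofReal_ne_top).trans ?_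
    refine ENNReal.div_le_of_le_mul ?_
    refine (hd.lintegral_sqrt_far_le hs hf₀ hP₀ hm hF n Q (mul_pos hr0 hb) hsmall hcov).trans ?_
    rw [← ENNReal.ofReal_mul (by positivity)]
    refine ENNReal.ofReal_le_ofReal ?_
    have hsq : √m = √(δ / 2) * Real.exp ((-((4 + 2 * C) * n * a ^ 2) + -(n * b ^ 2)) / 2) := by
      rw [hmdef, hL, mul_assoc, ← Real.exp_add, Real.sqrt_mul (by positivity), Real.exp_half]
    have hone : √(2 / δ) * √(δ / 2) = 1 := by
      rw [← Real.sqrt_mul (by positivity), div_mul_div_cancel₀ hδ.ne', div_self (by norm_num),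
        Real.sqrt_one]
    have hexp : Real.exp (G * n * b ^ 2 - n * (r * b) ^ 2 / 18) ≤ Real.exp (-(C * n * a ^ 2)) *
        Real.exp ((-((4 + 2 * C) * n * a ^ 2) + -(n * b ^ 2)) / 2) := by
      rw [← Real.exp_add]
      refine Real.exp_le_exp.2 ?_
      have hu : (n : ℝ) * a ^ 2 ≤ n * b ^ 2 := by gcongr
      have hv : 0 ≤ (n : ℝ) * b ^ 2 := by positivity
      -- Using `a ≤ b`, the exponents to be beaten are `G` (entropy), `1 / 2` (weight), `2 + C`
      -- (half of `4 + 2 * C`) and `C` (target); their sum is `2 * C + G + 5 / 2`.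
      have hrr : 18 * (2 * C + G + 5 / 2) ≤ r ^ 2 := by nlinarith
      have h1 := mul_le_mul_of_nonneg_right hrr hv
      have h2 := mul_le_mul_of_nonneg_left hu (by positivity : 0 ≤ 2 * C + 2)
      nlinarith
    calc 2 * Real.exp (G * n * b ^ 2 - n * (r * b) ^ 2 / 18)
        ≤ 2 * (Real.exp (-(C * n * a ^ 2)) *
          Real.exp ((-((4 + 2 * C) * n * a ^ 2) + -(n * b ^ 2)) / 2)) * (√(2 / δ) * √(δ / 2)) := by
          rw [hone, mul_one]
          gcongr
      _ = _ := by rw [hsq]; ring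
  refine (measure_mono hsub).trans ((measure_union_le _ _).trans ((add_le_add hnear' hfar').trans
    (le_of_eq ?_)))
  rw [← ENNReal.ofReal_add (by positivity) (by positivity), add_mul]

theorem mul_log_le_mul_sq {n : ℕ} {a C : ℝ} (hn : 1 ≤ n) (hC : 0 < C)
    (ha : √((1 + 1 / C) * (Real.log n / n)) ≤ a) :
    (1 + 1 / C) * Real.log n ≤ n * a ^ 2 := by
  have hn' : (0 : ℝ) < n := by exact_mod_cast hn
  have h0 : 0 ≤ (1 + 1 / C) * (Real.log n / n) := by
    have := Real.log_natCast_nonneg n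
    positivity
  have h1 : (1 + 1 / C) * (Real.log n / n) ≤ a ^ 2 := (Real.sqrt_le_iff.1 ha).2
  calc (1 + 1 / C) * Real.log n = n * ((1 + 1 / C) * (Real.log n / n)) := by field_simp
    _ ≤ n * a ^ 2 := by gcongr

/-! ### Almost sure comparison of the evidences. -/

section model

variable {𝕏 : Type*} [MeasurableSpace 𝕏] {μ : Measure 𝕏} [SigmaFinite μ]
  {P₀ : Measure 𝕏} [IsProbabilityMeasure P₀] {f₀ : 𝕏 → ℝ}
  {d : (𝕏 → ℝ) → (𝕏 → ℝ) → ℝ} {s : ℝ}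

theorem DensityModel.infinitePi_evidence_lt_le (M : DensityModel μ) (hf₀ : f₀ ∈ densities μ)
    (hP₀ : P₀ = μ.withDensity fun x => ENNReal.ofReal (f₀ x)) (n : ℕ) {a : ℝ} (C : ℝ)
    (hQ : ENNReal.ofReal (Real.exp (-(n * a ^ 2))) ≤ M.priorMass (M.starBall f₀ a)) :
    (Measure.infinitePi fun _ : ℕ => P₀) {ω | M.evidence f₀ n ω <
      ENNReal.ofReal (Real.exp (-((4 + 2 * C) * n * a ^ 2)) / 2)} ≤
      ENNReal.ofReal (2 * Real.exp (-(C * n * a ^ 2))) := by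
  let _ := M.sigmaField
  have := M.isProbabilityMeasure
  exact infinitePi_lintegral_likelihoodRatio_lt_le (F := fun t : M.carrier => (t : 𝕏 → ℝ)) hf₀ hP₀
    (M.measurable_eval.comp measurable_swap) (fun t => M.subset_densities t.2) n M.prior C
    (hQ.trans (measure_mono fun t ht => ht.2))

theorem IsAdmissibleDistance.infinitePi_lt_mul_evidence_le (hd : IsAdmissibleDistance μ d s)
    (hs : 0 < s) (M : DensityModel μ) (hf₀ : f₀ ∈ densities μ)
    (hP₀ : P₀ = μ.withDensity fun x => ENNReal.ofReal (f₀ x)) (n : ℕ)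
    {w : ℝ≥0∞} {a b C G K r δ : ℝ}
    (ha : 0 < a) (hab : a ≤ b) (hC : 0 < C) (hG : 0 < G) (hr : 700 * (2 * C + G + 2) < r)
    (hK : 0 ≤ K) (hδ : 0 < δ) (hsmall : Real.exp (-(n * (r * b) ^ 2 / 18)) ≤ 1 / 2)
    (hcov : ∀ η, r * b ≤ η → (coveringNumber μ d (η / 3) (M.distBall d f₀ (2 * η)) : ℝ≥0∞) ≤
      ENNReal.ofReal (Real.exp (G * n * b ^ 2)))
    (hw : w ≤ ENNReal.ofReal (Real.exp (n * b ^ 2)))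
    (hnear : w * M.priorMass (M.distBall d f₀ (r * b)) ≤
      ENNReal.ofReal (K * Real.exp (-((4 + 3 * C) * n * a ^ 2)))) :
    (Measure.infinitePi fun _ : ℕ => P₀)
      {ω | ENNReal.ofReal (δ * Real.exp (-((4 + 2 * C) * n * a ^ 2))) < w * M.evidence f₀ n ω} ≤
      ENNReal.ofReal ((2 * K / δ + 2 * √(2 / δ)) * Real.exp (-(C * n * a ^ 2))) := by
  let _ := M.sigmaField
  have := M.isProbabilityMeasure
  refine hd.infinitePi_lt_mul_lintegral_likelihoodRatio_le
    (F := fun t : M.carrier => (t : 𝕏 → ℝ)) hs hf₀ hP₀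
    (M.measurable_eval.comp measurable_swap) (fun t => M.subset_densities t.2) n M.prior
    ha hab hC hG hr hK hδ hsmall (fun η hη => ?_) hw ?_
  · obtain ⟨S, hS, hcovS, hcard⟩ := exists_cover_of_coveringNumber_le (hcov η hη)
    exact ⟨S, hS, fun t ht => hcovS t ⟨t.2, ht⟩, hcard⟩
  · refine le_trans (mul_le_mul_right (measure_mono fun t ht => ?_) w) hnear
    exact ⟨t.2, ht⟩

/-- The weighted evidence of the models `M` is almost surely of smaller order than the evidence of
the models `M'`. -/
theorem IsAdmissibleDistance.ae_eventually_evidence_le (hd : IsAdmissibleDistance μ d s)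
    (hs : 0 < s) (hf₀ : f₀ ∈ densities μ)
    (hP₀ : P₀ = μ.withDensity fun x => ENNReal.ofReal (f₀ x))
    (M M' : ℕ → DensityModel μ) {w : ℕ → ℝ≥0∞} {a b : ℕ → ℝ} {C G r : ℝ}
    (ha : ∀ n : ℕ, 1 ≤ n → √((1 + 1 / C) * (Real.log n / n)) ≤ a n)
    (hab : ∀ n, 1 ≤ n → a n ≤ b n) (hC : 0 < C) (hG : 0 < G)
    (hr : 700 * (2 * C + G + 2) < r)
    (hcov : ∀ n : ℕ, 1 ≤ n → ∀ η, r * b n ≤ η →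
      (coveringNumber μ d (η / 3) ((M n).distBall d f₀ (2 * η)) : ℝ≥0∞) ≤
        ENNReal.ofReal (Real.exp (G * n * b n ^ 2)))
    (hw : ∀ n : ℕ, 1 ≤ n → w n ≤ ENNReal.ofReal (Real.exp (n * b n ^ 2)))
    (hprior : ∀ n : ℕ, 1 ≤ n → ENNReal.ofReal (Real.exp (-(n * a n ^ 2))) ≤
      (M' n).priorMass ((M' n).starBall f₀ (a n)))
    (hnear : ∃ K : ℝ, ∀ᶠ n : ℕ in atTop,
      w n * (M n).priorMass ((M n).distBall d f₀ (r * b n)) ≤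
        ENNReal.ofReal (K * Real.exp (-((4 + 3 * C) * n * a n ^ 2)))) :
    ∀ᵐ ω ∂(Measure.infinitePi fun _ : ℕ => P₀), ∀ k : ℕ, ∀ᶠ n : ℕ in atTop,
      w n * (M n).evidence f₀ n ω ≤
        ENNReal.ofReal ((1 / (k + 1)) * Real.exp (-((4 + 2 * C) * n * a n ^ 2))) ∧
      ENNReal.ofReal (Real.exp (-((4 + 2 * C) * n * a n ^ 2)) / 2) ≤
        (M' n).evidence f₀ n ω := by
  obtain ⟨K, hK⟩ := hnear
  have hlog : ∀ n : ℕ, 1 ≤ n → (1 + 1 / C) * Real.log n ≤ n * a n ^ 2 := fun n hn =>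
    mul_log_le_mul_sq hn hC (ha n hn)
  -- The factor `1 + 1 / C` in the rate condition is what pushes the exponent beyond `1`, making the
  -- series summable.
  have hexp : ∀ n : ℕ, 1 ≤ n → Real.exp (-(C * n * a n ^ 2)) ≤ (n : ℝ) ^ (-(C + 1)) := by
    intro n hn
    rw [Real.rpow_def_of_pos (by exact_mod_cast hn)]
    refine Real.exp_le_exp.2 ?_
    have h1 := mul_le_mul_of_nonneg_left (hlog n hn) hC.le
    have h2 : C * ((1 + 1 / C) * Real.log n) = (C + 1) * Real.log n := by field_simp
    nlinarith
  have hsum : Summable fun n : ℕ => (n : ℝ) ^ (-(C + 1)) :=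
    Real.summable_nat_rpow.2 (by linarith)
  refine ae_all_iff.2 fun k => ?_
  have hδ : (0 : ℝ) < 1 / (k + 1) := by positivity
  generalize (1 : ℝ) / (k + 1) = δ at hδ
  have hupper : ∀ᵐ ω ∂(Measure.infinitePi fun _ : ℕ => P₀), ∀ᶠ n : ℕ in atTop,
      ω ∉ {ω | ENNReal.ofReal (δ * Real.exp (-((4 + 2 * C) * n * a n ^ 2))) <
        w n * (M n).evidence f₀ n ω} := by
    refine ae_eventually_notMem_of_eventually_le (hsum.mul_left (2 * |K| / δ + 2 * √(2 / δ))) ?_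
    -- At `n = 1` the logarithm vanishes and `a n` could be zero; from `n = 2` on, `n * a n ^ 2 ≥
    -- log 2`, which also gives the ratio at most `1 / 2`.
    filter_upwards [hK, eventually_ge_atTop 2] with n hKn hn
    have hn1 : 1 ≤ n := by omega
    have hn0 : (0 : ℝ) < n := by exact_mod_cast hn1
    have hl2 : Real.log 2 ≤ Real.log n := Real.log_le_log (by norm_num) (by exact_mod_cast hn)
    have hl0 : 0 < Real.log 2 := Real.log_pos (by norm_num)
    have hna : Real.log 2 ≤ n * a n ^ 2 := by
      refine le_trans ?_ (hlog n hn1)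
      have : 0 < 1 / C := by positivity
      nlinarith
    have ha0 : 0 < a n := by
      refine lt_of_le_of_ne ((Real.sqrt_nonneg _).trans (ha n hn1)) fun h => ?_
      rw [← h] at hna
      norm_num at hna
      linarith
    have hsmall : Real.exp (-(n * (r * b n) ^ 2 / 18)) ≤ 1 / 2 := by
      have h1 : (1 / 2 : ℝ) = Real.exp (-Real.log 2) := by
        rw [Real.exp_neg, Real.exp_log (by norm_num), one_div]
      rw [h1]
      refine Real.exp_le_exp.2 (neg_le_neg (hna.trans ?_))
      have h2 : (n : ℝ) * a n ^ 2 ≤ n * b n ^ 2 := by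
        have := hab n hn1
        gcongr
      have h3 : 0 ≤ (n : ℝ) * b n ^ 2 := by positivity
      have h4 : 18 ≤ r ^ 2 := by nlinarith
      have h5 := mul_le_mul_of_nonneg_right h4 h3
      rw [mul_pow]
      linarith
    refine (hd.infinitePi_lt_mul_evidence_le hs (M n) hf₀ hP₀ n ha0 (hab n hn1) hC hG hr
      (abs_nonneg K) hδ hsmall (hcov n hn1) (hw n hn1) (hKn.trans ?_)).trans ?_
    · gcongr
      exact le_abs_self K
    · gcongr
      exact hexp n hn1
  have hlower : ∀ᵐ ω ∂(Measure.infinitePi fun _ : ℕ => P₀), ∀ᶠ n : ℕ in atTop,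
      ω ∉ {ω | (M' n).evidence f₀ n ω <
        ENNReal.ofReal (Real.exp (-((4 + 2 * C) * n * a n ^ 2)) / 2)} := by
    refine ae_eventually_notMem_of_eventually_le (hsum.mul_left 2) ?_
    filter_upwards [eventually_ge_atTop 1] with n hn
    refine ((M' n).infinitePi_evidence_lt_le hf₀ hP₀ n C (hprior n hn)).trans ?_
    gcongr
    exact hexp n hn
  filter_upwards [hupper, hlower] with ω h1 h2
  filter_upwards [h1, h2] with n h3 h4
  exact ⟨not_lt.1 h3, not_lt.1 h4⟩

end model

/-! ### From evidences to Bayes factors. -/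

theorem EntropyCondition.coveringNumber_le {𝕏 : Type*} [MeasurableSpace 𝕏] {μ : Measure 𝕏}
    {M : DensityModel μ} {d : (𝕏 → ℝ) → (𝕏 → ℝ) → ℝ} {f₀ : 𝕏 → ℝ} {n : ℕ} {ε E G b η : ℝ}
    (h : EntropyCondition M d f₀ n ε E) (hη : ε ≤ η) (hE : E * ε ^ 2 ≤ G * b ^ 2) :
    (coveringNumber μ d (η / 3) (M.distBall d f₀ (2 * η)) : ℝ≥0∞) ≤
      ENNReal.ofReal (Real.exp (G * n * b ^ 2)) := by
  refine (h η hη).trans (ENNReal.ofReal_le_ofReal (Real.exp_le_exp.2 ?_))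
  have := mul_le_mul_of_nonneg_left hE (Nat.cast_nonneg (α := ℝ) n)
  linarith

/-- If `w = 0` then `v = 1`, and `1 / 0 = ∞` violates the finite bound. -/
theorem ne_zero_of_div_le_of_add_eq_one {v w : ℝ≥0∞} {x : ℝ} (h : v + w = 1)
    (hle : v / w ≤ ENNReal.ofReal x) : w ≠ 0 := by
  rintro rfl
  rw [add_zero] at h
  subst h
  simp at hle

theorem ne_top_of_add_eq_one {v w : ℝ≥0∞} (h : v + w = 1) : w ≠ ∞ := by
  rintro rfl
  simp at h

theorem mul_div_mul_eq_div_mul {v w x y : ℝ≥0∞} (h0 : w ≠ 0) (ht : w ≠ ∞) :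
    (w * x) / (v * y) = x / (v / w * y) := by
  have : v * y = w * (v / w * y) := by
    rw [← mul_assoc, ENNReal.mul_div_cancel h0 ht]
  rw [this, ENNReal.mul_div_mul_left _ _ h0 ht]

theorem mul_div_mul_eq_mul_div {v w x y : ℝ≥0∞} (h0 : w ≠ 0) (ht : w ≠ ∞) :
    (v * x) / (w * y) = v / w * x / y := by
  have : v * x = w * (v / w * x) := by
    rw [← mul_assoc, ENNReal.mul_div_cancel h0 ht]
  rw [this, ENNReal.mul_div_mul_left _ _ h0 ht]

theorem tendsto_div_top {x y : ℕ → ℝ≥0∞} {L : ℕ → ℝ} (hL : ∀ n, 0 < L n)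
    (h : ∀ k : ℕ, ∀ᶠ n : ℕ in atTop,
      x n ≤ ENNReal.ofReal (1 / (k + 1) * L n) ∧ ENNReal.ofReal (L n / 2) ≤ y n) :
    Tendsto (fun n => y n / x n) atTop (𝓝 ∞) := by
  refine ENNReal.tendsto_nhds_top fun m => ?_
  -- With `k = 2 * m + 1` the quotient of the two bounds is `(k + 1) / 2 = m + 1`, which exceeds
  -- `m`.
  filter_upwards [h (2 * m + 1)] with n ⟨h1, h2⟩
  have hLn := hL n
  refine lt_of_lt_of_le ?_ (ENNReal.div_le_div h2 h1)
  rw [← ENNReal.ofReal_div_of_pos (by positivity)]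
  have : L n / 2 / (1 / ((2 * m + 1 : ℕ) + 1) * L n) = m + 1 := by
    push_cast
    field_simp
    ring
  rw [this, ← ENNReal.ofReal_natCast]
  exact (ENNReal.ofReal_lt_ofReal_iff (by positivity)).2 (by linarith)

theorem tendsto_div_zero {x y : ℕ → ℝ≥0∞} {L : ℕ → ℝ} (hL : ∀ n, 0 < L n)
    (h : ∀ k : ℕ, ∀ᶠ n : ℕ in atTop,
      x n ≤ ENNReal.ofReal (1 / (k + 1) * L n) ∧ ENNReal.ofReal (L n / 2) ≤ y n) :
    Tendsto (fun n => x n / y n) atTop (𝓝 0) := by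
  have h1 := (tendsto_inv_iff (a := (∞ : ℝ≥0∞))).2 (tendsto_div_top hL h)
  rw [ENNReal.inv_top] at h1
  refine h1.congr' ?_
  filter_upwards [h 0] with n ⟨h2, h3⟩
  refine ENNReal.inv_div (Or.inl (h2.trans_lt ENNReal.ofReal_lt_top).ne) (Or.inr ?_)
  exact (lt_of_lt_of_le (ENNReal.ofReal_pos.2 (half_pos (hL n))) h3).ne'

end

theorem corollary2p5 {𝕏 : Type*} [MeasurableSpace 𝕏] (μ : Measure 𝕏) [SigmaFinite μ]
    (P₀ : Measure 𝕏) [IsProbabilityMeasure P₀]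
    (f₀ : 𝕏 → ℝ) (hf₀ : f₀ ∈ densities μ)
    (hP₀ : P₀ = μ.withDensity (fun x => ENNReal.ofReal (f₀ x)))
    (d : (𝕏 → ℝ) → (𝕏 → ℝ) → ℝ) (s : ℝ) (hs : 0 < s) (hd : IsAdmissibleDistance μ d s)
    (M₁ M₂ : ℕ → DensityModel μ)
    (w₁ w₂ : ℕ → ℝ≥0∞) (hw : ∀ n, 1 ≤ n → w₁ n + w₂ n = 1)
    (ε₁ ε₂ : ℕ → ℝ) (C G E₁ E₂ r : ℝ)
    (hC : 0 < C) (hG : 0 < G) (hE₁ : 0 < E₁) (hE₂ : 0 < E₂)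
    (hent₁ : ∀ n, 1 ≤ n → EntropyCondition (M₁ n) d f₀ n (ε₁ n) E₁)
    (hent₂ : ∀ n, 1 ≤ n → EntropyCondition (M₂ n) d f₀ n (ε₂ n) E₂)
    (hε₁₂ : ∀ n, 1 ≤ n → ε₂ n < ε₁ n)
    (hε₂ : ∀ n : ℕ, 1 ≤ n → √((1 + 1 / C) * (Real.log n / n)) ≤ ε₂ n)
    (hr : 700 * (2 * C + G + 2) < r) :
    ((E₁ ≤ G ∧ E₂ ≤ G) →
      (∀ n : ℕ, 1 ≤ n → ENNReal.ofReal (Real.exp (-(n * ε₂ n ^ 2))) ≤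
        (M₂ n).priorMass ((M₂ n).starBall f₀ (ε₂ n))) →
      (∃ K : ℝ, ∀ᶠ n : ℕ in atTop,
        w₁ n / w₂ n * (M₁ n).priorMass ((M₁ n).distBall d f₀ (r * ε₁ n)) ≤
          ENNReal.ofReal (K * Real.exp (-((4 + 3 * C) * n * ε₂ n ^ 2)))) →
      (∀ n : ℕ, 1 ≤ n → w₁ n / w₂ n ≤ ENNReal.ofReal (Real.exp (n * ε₁ n ^ 2))) →
      ∀ᵐ ω ∂(Measure.infinitePi (fun _ : ℕ => P₀)),
        Tendsto (fun n => bayesFactor (M₁ n) (M₂ n) (w₁ n) (w₂ n) f₀ n ω) atTop (𝓝 ∞)) ∧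
    ((E₁ ≤ G ∧ ∀ n, 1 ≤ n → E₂ * ε₂ n ^ 2 ≤ G * ε₁ n ^ 2) →
      (∀ n : ℕ, 1 ≤ n → ENNReal.ofReal (Real.exp (-(n * ε₁ n ^ 2))) ≤
        (M₁ n).priorMass ((M₁ n).starBall f₀ (ε₁ n))) →
      (∃ K : ℝ, ∀ᶠ n : ℕ in atTop,
        w₂ n / w₁ n * (M₂ n).priorMass ((M₂ n).distBall d f₀ (r * ε₁ n)) ≤
          ENNReal.ofReal (K * Real.exp (-((4 + 3 * C) * n * ε₁ n ^ 2)))) →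
      (∀ n : ℕ, 1 ≤ n → w₂ n / w₁ n ≤ ENNReal.ofReal (Real.exp (n * ε₁ n ^ 2))) →
      ∀ᵐ ω ∂(Measure.infinitePi (fun _ : ℕ => P₀)),
        Tendsto (fun n => bayesFactor (M₁ n) (M₂ n) (w₁ n) (w₂ n) f₀ n ω) atTop (𝓝 0)) := by
  have hε₂0 : ∀ n, 1 ≤ n → 0 ≤ ε₂ n := fun n hn => (Real.sqrt_nonneg _).trans (hε₂ n hn)
  have hε₁ : ∀ n, 1 ≤ n → 0 ≤ ε₁ n := fun n hn => (hε₂0 n hn).trans (hε₁₂ n hn).le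
  have hr1 : 1 ≤ r := by linarith
  have hrε : ∀ n, 1 ≤ n → ε₁ n ≤ r * ε₁ n := fun n hn => le_mul_of_one_le_left (hε₁ n hn) hr1
  constructor
  · rintro ⟨hE, -⟩ hprior hnear hratio
    have hcov : ∀ n : ℕ, 1 ≤ n → ∀ η, r * ε₁ n ≤ η →
        (coveringNumber μ d (η / 3) ((M₁ n).distBall d f₀ (2 * η)) : ℝ≥0∞) ≤
          ENNReal.ofReal (Real.exp (G * n * ε₁ n ^ 2)) := fun n hn η hη =>
      (hent₁ n hn).coveringNumber_le ((hrε n hn).trans hη)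
        (mul_le_mul_of_nonneg_right hE (sq_nonneg _))
    -- Two rates are at work: `ε₂` governs the evidence of the second model and the level `L`, while
    -- `ε₁` governs the entropy, the weights and the near–far split of the first.
    filter_upwards [hd.ae_eventually_evidence_le hs hf₀ hP₀ M₁ M₂ hε₂ (fun n hn => (hε₁₂ n hn).le)
      hC hG hr hcov hratio hprior hnear] with ω hω
    refine (tendsto_div_top (fun n => Real.exp_pos _) hω).congr' ?_
    filter_upwards [eventually_ge_atTop 1] with n hn
    exact (mul_div_mul_eq_div_mul (ne_zero_of_div_le_of_add_eq_one (hw n hn) (hratio n hn))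
      (ne_top_of_add_eq_one (hw n hn))).symm
  · rintro ⟨-, hE⟩ hprior hnear hratio
    have hcov : ∀ n : ℕ, 1 ≤ n → ∀ η, r * ε₁ n ≤ η →
        (coveringNumber μ d (η / 3) ((M₂ n).distBall d f₀ (2 * η)) : ℝ≥0∞) ≤
          ENNReal.ofReal (Real.exp (G * n * ε₁ n ^ 2)) := fun n hn η hη =>
      (hent₂ n hn).coveringNumber_le ((hε₁₂ n hn).le.trans ((hrε n hn).trans hη)) (hE n hn)
    have hw' : ∀ n, 1 ≤ n → w₂ n + w₁ n = 1 := fun n hn => (add_comm _ _).trans (hw n hn)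
    -- The roles are exchanged, and the single rate `ε₁` serves both bounds.
    filter_upwards [hd.ae_eventually_evidence_le hs hf₀ hP₀ M₂ M₁
      (fun n hn => (hε₂ n hn).trans (hε₁₂ n hn).le) (fun n _ => le_rfl)
      hC hG hr hcov hratio hprior hnear] with ω hω
    refine (tendsto_div_zero (fun n => Real.exp_pos _) hω).congr' ?_
    filter_upwards [eventually_ge_atTop 1] with n hn
    exact (mul_div_mul_eq_mul_div (ne_zero_of_div_le_of_add_eq_one (hw' n hn) (hratio n hn))
      (ne_top_of_add_eq_one (hw' n hn))).symm
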